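/- Fix the number $K$ of topics and the number $m$ of nodes. There are a constant $c>0$, depending only on $K$ and $m$, and a constant $C(p,\gamma)$ for all $p,\gamma>0$, depending only on $K,m,p,\gamma$, such that for every $\varepsilon>0$ there is a polynomial-time algorithm $\mathcal A$ (depending only on $K,m,\varepsilon$) with the following property. The algorithm takes a real $n\times n$ matrix as input ($n$ arbitrary) and outputs an $n\times K$ matrix $\hat U$ and a $K\times n$ matrix $\hat\Phi$; it is a uniform real-RAM program (exact real arithmetic and comparisons at unit cost, rational constants), and on every $n\times n$ input it takes at most $T(n)$ steps, for a polynomial $T$. Let $n\ge 0$, let $U\in\mathbb R^{n\times K}$ be a walk-topic matrix, i.e. non-negative with columns summing to $1$, let $\Lambda$ be a random $K\times m$ coefficient matrix which is almost surely non-negative with columns summing to $1$, let $Y=U\Lambda$ and $\Sigma=\mathbb E[YY^{T}]=\mathbb E[U\Lambda\Lambda^TU^T]$. Write $\|A\|_1=\sum_{i,j}|A_{ij}|$. Let $\hat\Sigma\in\mathbb R^{n\times n}$ be any observation of $\Sigma$ with $\|\hat\Sigma-\Sigma\|_1\le c\,\varepsilon$, and let $(\hat U,\hat\Phi)$ be the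 output of $\mathcal A$ on $\hat\Sigma$. Then $\hat U$ and $\hat\Phi$ are non-negative and $$\|\hat U\hat\Phi-\Sigma\|_1\le\varepsilon .$$ Call row $w$ of $U$ an anchor of topic $k$ if $U_{wk}$ is its only nonzero entry. Suppose moreover that, for some $p,\gamma>0$, $U$ is $p$-separable, i.e. every topic $k$ has an anchor $w$ with $U_{wk}\ge p$, and that the topic second-moment matrix $R=\mathbb E[\Lambda\Lambda^T]$ has $\ell_1$-condition number at least $\gamma$, i.e. $\|xR\|_1\ge\gamma\|x\|_1$ for all $x\in\mathbb R^K$. Then there is a permutation $\sigma$ of the topics such that for every anchor row $w$ of $U$ $$\sum_{j=1}^K|\hat U_{w,\sigma(j)}-U_{w,j}|\le C(p,\gamma)\,\varepsilon .$$ -/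

import Mathlib

open MeasureTheory

/-! ### Real RAM

A uniform machine model with unit-cost exact real arithmetic. A program is a finite piece of syntax
whose only numerical constants are rational. The memory has natural-number registers (used as
counters and addresses; no multiplication, so that they stay small) and two-dimensional arrays of
reals addressed through those registers. Real numbers can be added, subtracted, multiplied, divided
and compared; there is no rounding. Loops are bounded, hence every program halts; the number of
executed instructions is counted. -/

namespace RealRAM

/-- The memory: natural-number registers, and arrays of reals (`real a i j` is the entry `(i, j)` of
the array number `a`). -/
structure State where
  nat : ℕ → ℕ
  real : ℕ → ℕ → ℕ → ℝ

/-- The address of a real: entry (content of register `row`, content of register `col`) of the array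
number `arr`. -/
structure Loc where
  arr : ℕ
  row : ℕ
  col : ℕ

inductive Op
  | add
  | sub
  | mul
  | div

/-- Division by zero returns zero. -/
noncomputable def Op.eval : Op → ℝ → ℝ → ℝ
  | .add, a, b => a + b
  | .sub, a, b => a - b
  | .mul, a, b => a * b
  | .div, a, b => a / b

/-- Programs. -/
inductive Program
  /-- do nothing -/
  | skip
  /-- register `x := c` -/
  | natConst (x c : ℕ)
  /-- register `x := y` -/
  | natCopy (x y : ℕ)
  /-- register `x := x + 1` -/
  | natSucc (x : ℕ)
  /-- register `x := x - 1` (truncated at zero) -/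
  | natPred (x : ℕ)
  /-- real `d := q` -/
  | realConst (d : Loc) (q : ℚ)
  /-- real `d := a` -/
  | realCopy (d a : Loc)
  /-- real `d := a op b` -/
  | realOp (o : Op) (d a b : Loc)
  /-- `P; Q` -/
  | seq (P Q : Program)
  /-- if register `x ≤` register `y` then `P` else `Q` -/
  | ifNat (x y : ℕ) (P Q : Program)
  /-- if real `a ≤` real `b` then `P` else `Q` -/
  | ifReal (a b : Loc) (P Q : Program)
  /-- for `x = 0, 1, …, N - 1` do `P`, where `N` is the content of register `y` on entry -/
  | loop (x y : ℕ) (P : Program)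

namespace State

def setNat (s : State) (x v : ℕ) : State :=
  { s with nat := Function.update s.nat x v }

noncomputable def get (s : State) (l : Loc) : ℝ :=
  s.real l.arr (s.nat l.row) (s.nat l.col)

noncomputable def set (s : State) (l : Loc) (v : ℝ) : State :=
  { s with real := fun a i j =>
      if a = l.arr ∧ i = s.nat l.row ∧ j = s.nat l.col then v else s.real a i j }

end State

/-- `N` rounds of a loop with counter `x` and body `f`: the final memory and the number of steps
(one step per round for the counter, plus the steps of the body). -/
def rounds (f : State → State × ℕ) (x : ℕ) (s : State) : ℕ → State × ℕ
  | 0 => (s, 0)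
  | N + 1 =>
    let r := rounds f x s N
    let q := f (r.1.setNat x N)
    (q.1, r.2 + 1 + q.2)

/-- Execution: the final memory and the number of executed instructions. -/
noncomputable def Program.exec : Program → State → State × ℕ
  | .skip, s => (s, 1)
  | .natConst x c, s => (s.setNat x c, 1)
  | .natCopy x y, s => (s.setNat x (s.nat y), 1)
  | .natSucc x, s => (s.setNat x (s.nat x + 1), 1)
  | .natPred x, s => (s.setNat x (s.nat x - 1), 1)
  | .realConst d q, s => (s.set d (q : ℝ), 1)
  | .realCopy d a, s => (s.set d (s.get a), 1)
  | .realOp o d a b, s => (s.set d (o.eval (s.get a) (s.get b)), 1)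
  | .seq P Q, s =>
    let r := P.exec s
    let q := Q.exec r.1
    (q.1, r.2 + q.2)
  | .ifNat x y P Q, s =>
    let r := if s.nat x ≤ s.nat y then P.exec s else Q.exec s
    (r.1, 1 + r.2)
  | .ifReal a b P Q, s =>
    let r := if s.get a ≤ s.get b then P.exec s else Q.exec s
    (r.1, 1 + r.2)
  | .loop x y P, s =>
    let r := rounds P.exec x s (s.nat y)
    (r.1, 1 + r.2)

/-- The initial memory for an `n × n` input matrix: register `0` holds `n`, array `0` holds the
matrix, everything else is zero. -/
noncomputable def input {n : ℕ} (S : Matrix (Fin n) (Fin n) ℝ) : State where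
  nat x := if x = 0 then n else 0
  real a i j := if h : a = 0 ∧ i < n ∧ j < n then S ⟨i, h.2.1⟩ ⟨j, h.2.2⟩ else 0

/-- Read the array number `a` as a matrix. -/
def State.matrix (s : State) (a r c : ℕ) : Matrix (Fin r) (Fin c) ℝ :=
  Matrix.of fun i j => s.real a i j

/-- The left factor (`n × K`, array `1`) that the program outputs on the input matrix `S`. -/
noncomputable def Program.leftFactor (P : Program) (K : ℕ) {n : ℕ}
    (S : Matrix (Fin n) (Fin n) ℝ) : Matrix (Fin n) (Fin K) ℝ :=
  (P.exec (input S)).1.matrix 1 n K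

/-- The right factor (`K × n`, array `2`) that the program outputs on the input matrix `S`. -/
noncomputable def Program.rightFactor (P : Program) (K : ℕ) {n : ℕ}
    (S : Matrix (Fin n) (Fin n) ℝ) : Matrix (Fin K) (Fin n) ℝ :=
  (P.exec (input S)).1.matrix 2 K n

/-- On every `n × n` input matrix the number of steps is at most a fixed polynomial in `n`. -/
def Program.PolyTime (P : Program) : Prop :=
  ∃ T : Polynomial ℕ, ∀ (n : ℕ) (S : Matrix (Fin n) (Fin n) ℝ),
    (P.exec (input S)).2 ≤ T.eval n

end RealRAM

/-! ### Topic models -/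

/-- The entrywise `ℓ¹` norm of a matrix. -/
def entrywiseL1 {n r : ℕ} (A : Matrix (Fin n) (Fin r) ℝ) : ℝ :=
  ∑ i, ∑ j, |A i j|

/-- Every column is a probability vector. -/
def ColumnStochastic {n r : ℕ} (A : Matrix (Fin n) (Fin r) ℝ) : Prop :=
  (∀ i j, 0 ≤ A i j) ∧ ∀ j, ∑ i, A i j = 1

/-- The entrywise expectation `E[X Xᵀ]` of a random matrix. -/
noncomputable def secondMoment {Ω : Type*} [MeasurableSpace Ω] (P : Measure Ω) {n r : ℕ}
    (X : Ω → Matrix (Fin n) (Fin r) ℝ) : Matrix (Fin n) (Fin n) ℝ :=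
  Matrix.of fun i j => ∫ ω, (X ω * (X ω).transpose) i j ∂P

/-- Row `w` of `A` is an anchor for column `k`: its single nonzero entry is `A w k`. -/
def IsAnchor {n r : ℕ} (A : Matrix (Fin n) (Fin r) ℝ) (w : Fin n) (k : Fin r) : Prop :=
  A w k ≠ 0 ∧ ∀ j, j ≠ k → A w j = 0

/-- `p`-separable matrices: non-negative, and every column has an anchor row of weight at least
`p`. -/
def PSeparable {n r : ℕ} (p : ℝ) (A : Matrix (Fin n) (Fin r) ℝ) : Prop :=
  (∀ i j, 0 ≤ A i j) ∧ ∀ k, ∃ w, IsAnchor A w k ∧ p ≤ A w k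

/-- The `ℓ¹` condition number of `R` is at least `γ`: `‖x R‖₁ ≥ γ ‖x‖₁` for all row vectors. -/
def L1Conditioned {r : ℕ} (γ : ℝ) (R : Matrix (Fin r) (Fin r) ℝ) : Prop :=
  ∀ x : Fin r → ℝ, γ * ∑ k, |x k| ≤ ∑ j, |Matrix.vecMul x R j|

namespace RealRAM

/-! ### Programs evaluating real functions of the input -/

/-- The memory holds an input of size `n` with entries `S`, and register `1` is zero. -/
structure Holds (n : ℕ) (S : ℕ → ℕ → ℝ) (s : State) : Prop where
  size : s.nat 0 = n
  zero : s.nat 1 = 0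
  data : s.real 0 = S

/-- Two memories agree on the registers and arrays of number less than `k`. -/
structure Agree (k : ℕ) (s t : State) : Prop where
  nat : ∀ x < k, t.nat x = s.nat x
  real : ∀ a < k, t.real a = s.real a

theorem Agree.trans {k : ℕ} {s t u : State} (h : Agree k s t) (h' : Agree k t u) :
    Agree k s u :=
  ⟨fun x hx => (h'.nat x hx).trans (h.nat x hx), fun a ha => (h'.real a ha).trans (h.real a ha)⟩

theorem Agree.mono {j k : ℕ} {s t : State} (hjk : j ≤ k) (h : Agree k s t) : Agree j s t :=
  ⟨fun x hx => h.nat x (hx.trans_le hjk), fun a ha => h.real a (ha.trans_le hjk)⟩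

theorem Holds.of_agree {n k : ℕ} {S : ℕ → ℕ → ℝ} {s t : State} (h : Holds n S s) (hk : 2 ≤ k)
    (hst : Agree k s t) : Holds n S t :=
  ⟨(hst.nat 0 (by omega)).trans h.size, (hst.nat 1 (by omega)).trans h.zero,
    (hst.real 0 (by omega)).trans h.data⟩

/-- The address of the entry `(0, 0)` of an array. -/
def cell (a : ℕ) : Loc := ⟨a, 1, 1⟩

theorem get_cell {s : State} (h : s.nat 1 = 0) (a : ℕ) : s.get (cell a) = s.real a 0 0 := by
  simp [State.get, cell, h]

@[simp] theorem set_nat (s : State) (l : Loc) (v : ℝ) : (s.set l v).nat = s.nat := rfl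

theorem set_real_of_ne (s : State) (l : Loc) (v : ℝ) {a : ℕ} (h : a ≠ l.arr) :
    (s.set l v).real a = s.real a := by
  funext i j; simp [State.set, h]

theorem set_cell_real {s : State} (h : s.nat 1 = 0) (a : ℕ) (v : ℝ) :
    (s.set (cell a) v).real a 0 0 = v := by
  simp [State.set, cell, h]

@[simp] theorem setNat_real (s : State) (x v : ℕ) : (s.setNat x v).real = s.real := rfl

@[simp] theorem setNat_nat_self (s : State) (x v : ℕ) : (s.setNat x v).nat x = v := by
  simp [State.setNat]

theorem setNat_nat_of_ne (s : State) {x y : ℕ} (v : ℕ) (h : y ≠ x) :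
    (s.setNat x v).nat y = s.nat y := by
  simp [State.setNat, h]

theorem agree_set (s : State) (l : Loc) (v : ℝ) {k : ℕ} (h : k ≤ l.arr) : Agree k s (s.set l v) :=
  ⟨fun _ _ => rfl, fun a ha => set_real_of_ne s l v (by omega)⟩

theorem agree_setNat (s : State) {x : ℕ} (v : ℕ) {k : ℕ} (h : k ≤ x) :
    Agree k s (s.setNat x v) :=
  ⟨fun y hy => setNat_nat_of_ne s v (by omega), fun _ _ => rfl⟩

theorem rounds_induction {f : State → State × ℕ} {x : ℕ} {s : State} {N t : ℕ}
    (I : ℕ → State → Prop) (h0 : I 0 s)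
    (hs : ∀ i < N, ∀ r, I i r → I (i + 1) (f (r.setNat x i)).1 ∧ (f (r.setNat x i)).2 ≤ t) :
    I N (rounds f x s N).1 ∧ (rounds f x s N).2 ≤ N * (1 + t) := by
  induction N with
  | zero => exact ⟨h0, by simp [rounds]⟩
  | succ N ih =>
    obtain ⟨h1, h2⟩ := ih fun i hi => hs i (by omega)
    obtain ⟨h3, h4⟩ := hs N (by omega) _ h1
    refine ⟨h3, ?_⟩
    simp only [rounds]
    linarith

/-- The program leaves the memory below `k` intact, and puts `y` into the cell `k` within `t`
steps. -/
structure Evaluates (P : Program) (k : ℕ) (y : ℝ) (t : ℕ) (s : State) : Prop where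
  agree : Agree k s (P.exec s).1
  value : (P.exec s).1.real k 0 0 = y
  steps : (P.exec s).2 ≤ t

/-- A real function of the input and of the indices `v` that can be evaluated by a program in
polynomial time, for any placement `ρ` of the indices in the registers below a level `k`. -/
def PolyComputable {ι : Type} (f : ℕ → (ℕ → ℕ → ℝ) → (ι → ℕ) → ℝ) : Prop :=
  ∃ (P : (ι → ℕ) → ℕ → Program) (T : Polynomial ℕ), ∀ ρ k, 4 ≤ k → (∀ i, ρ i < k) →
    ∀ n S s, Holds n S s → Evaluates (P ρ k) k (f n S fun i => s.nat (ρ i)) (T.eval n) s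

namespace PolyComputable

variable {ι : Type} {f g h l : ℕ → (ℕ → ℕ → ℝ) → (ι → ℕ) → ℝ}

theorem const (q : ℚ) : PolyComputable fun _ _ (_ : ι → ℕ) => (q : ℝ) := by
  refine ⟨fun _ k => .realConst (cell k) q, 1, fun ρ k hk hρ n S s hs => ⟨?_, ?_, ?_⟩⟩
  · exact agree_set _ _ _ le_rfl
  · exact set_cell_real hs.zero _ _
  · simp [Program.exec]

theorem entry (i j : ι) : PolyComputable fun _ S (v : ι → ℕ) => S (v i) (v j) := by
  refine ⟨fun ρ k => .realCopy (cell k) ⟨0, ρ i, ρ j⟩, 1, fun ρ k hk hρ n S s hs => ⟨?_, ?_, ?_⟩⟩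
  · exact agree_set _ _ _ le_rfl
  · refine (set_cell_real hs.zero _ _).trans ?_
    simp [State.get, hs.data]
  · simp [Program.exec]

theorem op (o : Op) (hf : PolyComputable f) (hg : PolyComputable g) :
    PolyComputable fun n S v => o.eval (f n S v) (g n S v) := by
  obtain ⟨P, T, hP⟩ := hf
  obtain ⟨Q, U, hQ⟩ := hg
  refine ⟨fun ρ k => .seq (P ρ k) (.seq (Q ρ (k + 1)) (.realOp o (cell k) (cell k) (cell (k + 1)))),
    T + (U + 1), fun ρ k hk hρ n S s hs => ?_⟩
  have h1 := hP ρ k hk hρ n S s hs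
  set s1 := ((P ρ k).exec s).1 with e1
  have hs1 := hs.of_agree (by omega) h1.agree
  have h2 := hQ ρ (k + 1) (by omega) (fun i => (hρ i).trans (by omega)) n S s1 hs1
  set s2 := ((Q ρ (k + 1)).exec s1).1 with e2
  have hs2 := hs1.of_agree (by omega) h2.agree
  have hv : (fun i => s1.nat (ρ i)) = fun i => s.nat (ρ i) :=
    funext fun i => h1.agree.nat _ (hρ i)
  refine ⟨?_, ?_, ?_⟩
  · exact (h1.agree.trans (h2.agree.mono (by omega))).trans (agree_set _ _ _ le_rfl)
  · refine (set_cell_real hs2.zero _ _).trans ?_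
    rw [get_cell hs2.zero, get_cell hs2.zero, h2.value, h2.agree.real k (by omega), h1.value, hv]
  · have := h1.steps
    have := h2.steps
    simp only [Program.exec, ← e1, Polynomial.eval_add, Polynomial.eval_one]
    omega

theorem ite_le (hf : PolyComputable f) (hg : PolyComputable g) (hh : PolyComputable h)
    (hl : PolyComputable l) :
    PolyComputable fun n S v => if f n S v ≤ g n S v then h n S v else l n S v := by
  obtain ⟨P, T, hP⟩ := hf
  obtain ⟨Q, U, hQ⟩ := hg
  obtain ⟨P', T', hP'⟩ := hh
  obtain ⟨Q', U', hQ'⟩ := hl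
  refine ⟨fun ρ k => .seq (P ρ k) (.seq (Q ρ (k + 1))
    (.ifReal (cell k) (cell (k + 1)) (P' ρ k) (Q' ρ k))),
    T + (U + (1 + (T' + U'))), fun ρ k hk hρ n S s hs => ?_⟩
  have h1 := hP ρ k hk hρ n S s hs
  set s1 := ((P ρ k).exec s).1 with e1
  have hs1 := hs.of_agree (by omega) h1.agree
  have h2 := hQ ρ (k + 1) (by omega) (fun i => (hρ i).trans (by omega)) n S s1 hs1
  set s2 := ((Q ρ (k + 1)).exec s1).1 with e2
  have hs2 := hs1.of_agree (by omega) h2.agree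
  have hv1 : (fun i => s1.nat (ρ i)) = fun i => s.nat (ρ i) :=
    funext fun i => h1.agree.nat _ (hρ i)
  have ha := h1.agree.trans (h2.agree.mono (by omega))
  have hv2 : (fun i => s2.nat (ρ i)) = fun i => s.nat (ρ i) :=
    funext fun i => ha.nat _ (hρ i)
  have h3 := hP' ρ k hk hρ n S s2 hs2
  have h4 := hQ' ρ k hk hρ n S s2 hs2
  have c1 : s2.get (cell k) = f n S fun i => s.nat (ρ i) := by
    rw [get_cell hs2.zero, h2.agree.real k (by omega), h1.value]
  have c2 : s2.get (cell (k + 1)) = g n S fun i => s.nat (ρ i) := by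
    rw [get_cell hs2.zero, h2.value, hv1]
  have t1 := h1.steps
  have t2 := h2.steps
  have t3 := h3.steps
  have t4 := h4.steps
  by_cases hc : f n S (fun i => s.nat (ρ i)) ≤ g n S (fun i => s.nat (ρ i))
  · refine ⟨?_, ?_, ?_⟩ <;> simp only [Program.exec, ← e1, ← e2, c1, c2, hc, if_true]
    · exact ha.trans h3.agree
    · rw [h3.value, hv2]
    · simp only [Polynomial.eval_add, Polynomial.eval_one]; omega
  · refine ⟨?_, ?_, ?_⟩ <;> simp only [Program.exec, ← e1, ← e2, c1, c2, hc, if_false]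
    · exact ha.trans h4.agree
    · rw [h4.value, hv2]
    · simp only [Polynomial.eval_add, Polynomial.eval_one]; omega

theorem ite_index_le (i j : ι) (hh : PolyComputable h) (hl : PolyComputable l) :
    PolyComputable fun n S v => if v i ≤ v j then h n S v else l n S v := by
  obtain ⟨P', T', hP'⟩ := hh
  obtain ⟨Q', U', hQ'⟩ := hl
  refine ⟨fun ρ k => .ifNat (ρ i) (ρ j) (P' ρ k) (Q' ρ k), 1 + (T' + U'),
    fun ρ k hk hρ n S s hs => ?_⟩
  have h3 := hP' ρ k hk hρ n S s hs
  have h4 := hQ' ρ k hk hρ n S s hs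
  have t3 := h3.steps
  have t4 := h4.steps
  by_cases hc : s.nat (ρ i) ≤ s.nat (ρ j)
  · refine ⟨?_, ?_, ?_⟩ <;> simp only [Program.exec, hc, if_true]
    · exact h3.agree
    · rw [h3.value]
    · simp only [Polynomial.eval_add, Polynomial.eval_one]; omega
  · refine ⟨?_, ?_, ?_⟩ <;> simp only [Program.exec, hc, if_false]
    · exact h4.agree
    · rw [h4.value]
    · simp only [Polynomial.eval_add, Polynomial.eval_one]; omega

/-- Add the index `i` in front of the indices `v`. -/
def cons (i : ℕ) (v : ι → ℕ) : Option ι → ℕ := fun o => o.elim i v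

theorem sum_range {f : ℕ → (ℕ → ℕ → ℝ) → (Option ι → ℕ) → ℝ} (hf : PolyComputable f) :
    PolyComputable fun n S (v : ι → ℕ) => ∑ i ∈ Finset.range n, f n S (cons i v) := by
  obtain ⟨P, T, hP⟩ := hf
  refine ⟨fun ρ k => .seq (.realConst (cell k) 0) (.loop k 0 (.seq (P (cons k ρ) (k + 1))
    (.realOp .add (cell k) (cell k) (cell (k + 1))))), 1 + (1 + Polynomial.X * (1 + (T + 1))),
    fun ρ k hk hρ n S s hs => ?_⟩
  set s0 := s.set (cell k) ((0 : ℚ) : ℝ) with e0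
  set B : Program := .seq (P (cons k ρ) (k + 1)) (.realOp .add (cell k) (cell k) (cell (k + 1)))
    with hB
  have ha0 : Agree k s s0 := agree_set _ _ _ le_rfl
  have key := rounds_induction (f := B.exec) (x := k) (s := s0) (N := n) (t := T.eval n + 1)
    (fun i r => Agree k s r ∧
      r.real k 0 0 = ∑ i ∈ Finset.range i, f n S (cons i fun i => s.nat (ρ i)))
    ⟨ha0, by rw [e0, set_cell_real hs.zero]; simp⟩ (by
      rintro i hi r ⟨hr, hv⟩
      set r0 := r.setNat k i with er
      have hr0 : Agree k s r0 := hr.trans (agree_setNat _ _ le_rfl)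
      have hs0 := hs.of_agree (by omega) hr0
      have h1 := hP (cons k ρ) (k + 1) (by omega) (by
        rintro (_ | j)
        · exact Nat.lt_succ_self k
        · exact (hρ j).trans (Nat.lt_succ_self k)) n S r0 hs0
      set r1 := ((P (cons k ρ) (k + 1)).exec r0).1 with er1
      have hs1 := hs0.of_agree (by omega) h1.agree
      have hidx : (fun o => r0.nat (cons k ρ o)) = cons i fun i => s.nat (ρ i) := by
        funext o
        rcases o with _ | j
        · exact setNat_nat_self _ _ _
        · exact hr0.nat _ (hρ j)
      refine ⟨⟨?_, ?_⟩, ?_⟩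
      · exact (hr0.trans (h1.agree.mono (by omega))).trans (agree_set _ _ _ le_rfl)
      · refine (set_cell_real hs1.zero _ _).trans ?_
        rw [get_cell hs1.zero, get_cell hs1.zero, h1.value, h1.agree.real k (by omega), hidx,
          Finset.sum_range_succ, ← hv]
        rfl
      · have := h1.steps
        simp only [hB, Program.exec]
        omega)
  have hn : s0.nat 0 = n := hs.size
  refine ⟨?_, ?_, ?_⟩
  · simp only [Program.exec, ← e0, hn]
    exact key.1.1
  · simp only [Program.exec, ← e0, hn]
    exact key.1.2
  · have := key.2
    change 1 + (1 + (rounds B.exec k s0 (s0.nat 0)).2) ≤ _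
    rw [hn]
    simp only [Polynomial.eval_add, Polynomial.eval_one, Polynomial.eval_mul, Polynomial.eval_X]
    omega

theorem add (hf : PolyComputable f) (hg : PolyComputable g) :
    PolyComputable fun n S v => f n S v + g n S v := op .add hf hg

theorem sub (hf : PolyComputable f) (hg : PolyComputable g) :
    PolyComputable fun n S v => f n S v - g n S v := op .sub hf hg

theorem mul (hf : PolyComputable f) (hg : PolyComputable g) :
    PolyComputable fun n S v => f n S v * g n S v := op .mul hf hg

theorem div (hf : PolyComputable f) (hg : PolyComputable g) :
    PolyComputable fun n S v => f n S v / g n S v := op .div hf hg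

theorem zero : PolyComputable fun _ _ (_ : ι → ℕ) => (0 : ℝ) := by
  simpa using const (ι := ι) 0

theorem abs (hf : PolyComputable f) : PolyComputable fun n S v => |f n S v| := by
  have := ite_le zero hf hf (sub zero hf)
  convert this using 4 with n S v
  split_ifs with h
  · exact abs_of_nonneg h
  · rw [zero_sub]; exact abs_of_nonpos (le_of_not_ge h)

theorem finset_sum {α : Type*} (t : Finset α) {F : α → ℕ → (ℕ → ℕ → ℝ) → (ι → ℕ) → ℝ}
    (hF : ∀ a, PolyComputable (F a)) : PolyComputable fun n S v => ∑ a ∈ t, F a n S v := by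
  classical
  induction t using Finset.induction_on with
  | empty => simpa using zero
  | insert a t ha ih =>
    simp only [Finset.sum_insert ha]
    exact add (hF a) ih

/-- A minimiser of `F` among `a` and the members of a list. -/
noncomputable def minimizer {α : Type*} (F : α → ℝ) (a : α) : List α → α
  | [] => a
  | b :: t => if F b ≤ F (minimizer F a t) then b else minimizer F a t

theorem minimizer_mem {α : Type*} (F : α → ℝ) (a : α) (t : List α) :
    minimizer F a t = a ∨ minimizer F a t ∈ t := by
  induction t with
  | nil => exact Or.inl rfl
  | cons b t ih =>
    simp only [minimizer]
    split_ifs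
    · simp
    · rcases ih with h | h
      · exact Or.inl h
      · exact Or.inr (List.mem_cons_of_mem _ h)

theorem minimizer_le {α : Type*} (F : α → ℝ) (a : α) (t : List α) {b : α} (hb : b ∈ t) :
    F (minimizer F a t) ≤ F b := by
  induction t with
  | nil => simp at hb
  | cons c t ih =>
    simp only [minimizer]
    rcases List.mem_cons.1 hb with rfl | h
    · split_ifs with h'
      · exact le_rfl
      · exact le_of_not_ge h'
    · split_ifs with h'
      · exact h'.trans (ih h)
      · exact ih h

theorem apply_minimizer {α : Type*} {F φ : α → ℕ → (ℕ → ℕ → ℝ) → (ι → ℕ) → ℝ}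
    (hF : ∀ a, PolyComputable (F a)) (hφ : ∀ a, PolyComputable (φ a)) (a : α) (t : List α) :
    PolyComputable fun n S v => φ (minimizer (fun b => F b n S v) a t) n S v := by
  induction t generalizing φ with
  | nil => exact hφ a
  | cons b t ih =>
    have := ite_le (hF b) (ih hF) (hφ b) (ih hφ)
    convert this using 4 with n S v
    simp only [minimizer]
    split_ifs <;> rfl

end PolyComputable

end RealRAM

namespace RealRAM

/-! ### Exhaustive search -/

/-- Two memories agree on the registers below `d + 2` and on the arrays below `d + 4` other than
those in `W`. -/
structure AgreeOff (d : ℕ) (W : Set ℕ) (s t : State) : Prop where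
  nat : ∀ x < d + 2, t.nat x = s.nat x
  real : ∀ a < d + 4, a ∉ W → t.real a = s.real a

theorem AgreeOff.refl (d : ℕ) (W : Set ℕ) (s : State) : AgreeOff d W s s :=
  ⟨fun _ _ => rfl, fun _ _ _ => rfl⟩

theorem AgreeOff.trans {d : ℕ} {W : Set ℕ} {s t u : State} (h : AgreeOff d W s t)
    (h' : AgreeOff d W t u) : AgreeOff d W s u :=
  ⟨fun x hx => (h'.nat x hx).trans (h.nat x hx),
    fun a ha hW => (h'.real a ha hW).trans (h.real a ha hW)⟩

theorem AgreeOff.mono {d : ℕ} {W W' : Set ℕ} {s t : State} (hW : W ⊆ W') (h : AgreeOff d W s t) :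
    AgreeOff d W' s t :=
  ⟨h.nat, fun a ha ha' => h.real a ha fun h' => ha' (hW h')⟩

theorem Agree.agreeOff {d : ℕ} {s t : State} (W : Set ℕ) (h : Agree (d + 4) s t) :
    AgreeOff d W s t :=
  ⟨fun x hx => h.nat x (by omega), fun a ha _ => h.real a ha⟩

theorem Holds.of_agreeOff {n d : ℕ} {W : Set ℕ} {S : ℕ → ℕ → ℝ} {s t : State} (h : Holds n S s)
    (h0 : 0 ∉ W) (hst : AgreeOff d W s t) : Holds n S t :=
  ⟨(hst.nat 0 (by omega)).trans h.size, (hst.nat 1 (by omega)).trans h.zero,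
    (hst.real 0 (by omega) h0).trans h.data⟩

/-- The entry `(i, j)` of an array or of its transpose. -/
def orient (tr : Bool) (f : ℕ → ℕ → ℝ) (i j : ℕ) : ℝ := if tr then f j i else f i j

/-- The address of entry (register `d + 2`, register `d + 3`) of an array or of its transpose. -/
def orientLoc (tr : Bool) (d arr : ℕ) : Loc :=
  if tr then ⟨arr, d + 3, d + 2⟩ else ⟨arr, d + 2, d + 3⟩

theorem orient_set_orientLoc (tr : Bool) (d arr : ℕ) (s : State) (v : ℝ) (i j : ℕ) :
    orient tr ((s.set (orientLoc tr d arr) v).real arr) i j =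
      if i = s.nat (d + 2) ∧ j = s.nat (d + 3) then v else orient tr (s.real arr) i j := by
  cases tr <;> simp [orient, orientLoc, State.set, and_comm]

theorem orientLoc_arr (tr : Bool) (d arr : ℕ) : (orientLoc tr d arr).arr = arr := by
  cases tr <;> rfl

/-- Fill column `j` of an array (or of its transpose) by the values that `Q` computes for the
index in register `d + 2`. -/
def fillColumn (tr : Bool) (d arr j : ℕ) (Q : Program) : Program :=
  .seq (.natConst (d + 3) j) (.loop (d + 2) 0 (.seq Q
    (.realCopy (orientLoc tr d arr) (cell (d + 4)))))

/-- The registers of the search parameters. -/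
def paramReg (d : ℕ) (i : Fin d) : ℕ := i + 2

theorem fillColumn_spec {tr : Bool} {d arr j n t : ℕ} {S : ℕ → ℕ → ℝ} {Q : Program}
    {F : (Fin d → ℕ) → ℕ → ℝ} (harr : 0 < arr) (harr' : arr < 4)
    (hQ : ∀ s, Holds n S s →
      Evaluates Q (d + 4) (F (fun i => s.nat (paramReg d i)) (s.nat (d + 2))) t s)
    {s : State} (hs : Holds n S s) :
    AgreeOff d {arr} s ((fillColumn tr d arr j Q).exec s).1 ∧
    (∀ i < n, orient tr (((fillColumn tr d arr j Q).exec s).1.real arr) i j =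
      F (fun i => s.nat (paramReg d i)) i) ∧
    (∀ i j', j' ≠ j → orient tr (((fillColumn tr d arr j Q).exec s).1.real arr) i j' =
      orient tr (s.real arr) i j') ∧
    ((fillColumn tr d arr j Q).exec s).2 ≤ 2 + n * (2 + t) := by
  set s0 := s.setNat (d + 3) j with e0
  set B : Program := .seq Q (.realCopy (orientLoc tr d arr) (cell (d + 4))) with hB
  have ha0 : AgreeOff d {arr} s s0 :=
    ⟨fun x hx => setNat_nat_of_ne _ _ (by omega), fun _ _ _ => rfl⟩
  have key := rounds_induction (f := B.exec) (x := d + 2) (s := s0) (N := n) (t := t + 1)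
    (fun i r => AgreeOff d {arr} s r ∧ r.nat (d + 3) = j ∧
      (∀ i' < i, orient tr (r.real arr) i' j = F (fun i => s.nat (paramReg d i)) i') ∧
      ∀ i' j', j' ≠ j → orient tr (r.real arr) i' j' = orient tr (s.real arr) i' j')
    ⟨ha0, setNat_nat_self _ _ _, by simp, fun _ _ _ => rfl⟩ (by
      rintro i hi r ⟨hr, hj, hf, hu⟩
      set r0 := r.setNat (d + 2) i with er
      have hr0 : AgreeOff d {arr} s r0 := hr.trans
        ⟨fun x hx => setNat_nat_of_ne _ _ (by omega), fun _ _ _ => rfl⟩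
      have hs0 := hs.of_agreeOff (by simp; omega) hr0
      have h1 := hQ r0 hs0
      set r1 := (Q.exec r0).1 with er1
      have hs1 := hs0.of_agree (by omega) h1.agree
      have ea : r1.real arr = r.real arr := h1.agree.real arr (by omega)
      have ei : r1.nat (d + 2) = i := by
        rw [h1.agree.nat _ (by omega)]; exact setNat_nat_self _ _ _
      have ej : r1.nat (d + 3) = j := by
        rw [h1.agree.nat _ (by omega), er, setNat_nat_of_ne _ _ (by omega), hj]
      have ev : r1.get (cell (d + 4)) = F (fun i => s.nat (paramReg d i)) i := by
        rw [get_cell hs1.zero, h1.value]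
        congr 1
        · funext p
          exact hr0.nat _ (by have := p.2; simp only [paramReg]; omega)
        · exact setNat_nat_self _ _ _
      have ex : (B.exec r0).1 = r1.set (orientLoc tr d arr) (r1.get (cell (d + 4))) := rfl
      refine ⟨⟨?_, ?_, ?_, ?_⟩, ?_⟩
      · rw [ex]
        refine (hr0.trans (h1.agree.agreeOff _)).trans ⟨fun _ _ => rfl, fun a ha haW => ?_⟩
        exact set_real_of_ne _ _ _ (by rw [orientLoc_arr]; simpa using haW)
      · exact ej
      · intro i' hi'
        rw [ex, orient_set_orientLoc, ei, ej, ev, ea]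
        by_cases h : i' = i
        · simp [h]
        · simp only [h, false_and, if_false]
          exact hf i' (by omega)
      · intro i' j' hj'
        rw [ex, orient_set_orientLoc, ei, ej, ea]
        simp only [hj', and_false, if_false]
        exact hu i' j' hj'
      · have := h1.steps
        change (Q.exec r0).2 + 1 ≤ _
        omega)
  have hn : s0.nat 0 = n := by rw [ha0.nat 0 (by omega), hs.size]
  have ex : ((fillColumn tr d arr j Q).exec s).1 = (rounds B.exec (d + 2) s0 n).1 := by
    rw [← hn]; rfl
  rw [ex]
  refine ⟨key.1.1, key.1.2.2.1, key.1.2.2.2, ?_⟩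
  change 1 + (1 + (rounds B.exec (d + 2) s0 (s0.nat 0)).2) ≤ _
  rw [hn]
  have h2 := key.2
  have : n * (1 + (t + 1)) = n * (2 + t) := by ring
  omega

/-- Fill several columns. -/
def fillColumns (tr : Bool) (d arr : ℕ) {K : ℕ} (Q : Fin K → Program) : List (Fin K) → Program
  | [] => .skip
  | j :: l => .seq (fillColumn tr d arr j (Q j)) (fillColumns tr d arr Q l)

theorem fillColumns_spec {tr : Bool} {d arr n K t : ℕ} {S : ℕ → ℕ → ℝ} {Q : Fin K → Program}
    {F : Fin K → (Fin d → ℕ) → ℕ → ℝ} (harr : 0 < arr) (harr' : arr < 4)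
    (hQ : ∀ j s, Holds n S s →
      Evaluates (Q j) (d + 4) (F j (fun i => s.nat (paramReg d i)) (s.nat (d + 2))) t s)
    (l : List (Fin K)) {s : State} (hs : Holds n S s) :
    AgreeOff d {arr} s ((fillColumns tr d arr Q l).exec s).1 ∧
    (∀ i < n, ∀ j ∈ l, orient tr (((fillColumns tr d arr Q l).exec s).1.real arr) i j =
      F j (fun i => s.nat (paramReg d i)) i) ∧
    (∀ i, ∀ j : Fin K, j ∉ l → orient tr (((fillColumns tr d arr Q l).exec s).1.real arr) i j =
      orient tr (s.real arr) i j) ∧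
    ((fillColumns tr d arr Q l).exec s).2 ≤ 1 + l.length * (2 + n * (2 + t)) := by
  induction l generalizing s with
  | nil => exact ⟨AgreeOff.refl _ _ _, by simp, by intros; rfl, by simp [fillColumns, Program.exec]⟩
  | cons j l ih =>
    obtain ⟨h1, h2, h3, h4⟩ := fillColumn_spec (tr := tr) (j := j) harr harr' (hQ j) hs
    set s1 := ((fillColumn tr d arr j (Q j)).exec s).1 with e1
    have hs1 := hs.of_agreeOff (by simp; omega) h1
    obtain ⟨g1, g2, g3, g4⟩ := ih hs1
    have hp : (fun i => s1.nat (paramReg d i)) = fun i => s.nat (paramReg d i) :=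
      funext fun p => h1.nat _ (by have := p.2; simp only [paramReg]; omega)
    have ex : ((fillColumns tr d arr Q (j :: l)).exec s).1 =
        ((fillColumns tr d arr Q l).exec s1).1 := rfl
    rw [ex]
    refine ⟨h1.trans g1, ?_, ?_, ?_⟩
    · intro i hi j' hj'
      by_cases hl : j' ∈ l
      · rw [g2 i hi j' hl, hp]
      · rw [g3 i j' hl]
        obtain rfl : j' = j := by simpa [hl] using hj'
        exact h2 i hi
    · intro i j' hj'
      simp only [List.mem_cons, not_or] at hj'
      rw [g3 i j' hj'.2, h3 i j' fun h => hj'.1 (Fin.ext h)]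
    · change ((fillColumn tr d arr j (Q j)).exec s).2 + ((fillColumns tr d arr Q l).exec s1).2 ≤ _
      rw [List.length_cons, add_mul, one_mul]
      omega

/-- Candidates for the search: constants `c` and indices `v`; every candidate has a score and an
output, the rows of the left and the columns of the right factor. -/
structure SearchProblem (α : Type*) (d K : ℕ) where
  score : α → ℕ → (ℕ → ℕ → ℝ) → (Fin d → ℕ) → ℝ
  left : α → Fin K → ℕ → (ℕ → ℕ → ℝ) → (Fin d → ℕ) → ℕ → ℝ
  right : α → Fin K → ℕ → (ℕ → ℕ → ℝ) → (Fin d → ℕ) → ℕ → ℝ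
  score_computable : ∀ a, PolyComputable (score a)
  left_computable : ∀ a k, PolyComputable fun n S (v : Option (Fin d) → ℕ) =>
    left a k n S (fun i => v (some i)) (v none)
  right_computable : ∀ a k, PolyComputable fun n S (v : Option (Fin d) → ℕ) =>
    right a k n S (fun i => v (some i)) (v none)

namespace SearchProblem

variable {α : Type*} {d K : ℕ} (X : SearchProblem α d K)

/-- Arrays `1` and `2` hold the output of the best candidate found so far, array `3` its score. -/
structure Inv (n : ℕ) (S : ℕ → ℕ → ℝ) (s : State) : Prop where
  holds : Holds n S s
  found : (s.real 3 0 0 = -1 ∧ s.real 1 = 0 ∧ s.real 2 = 0) ∨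
    ∃ a v, (∀ i, v i < n) ∧ X.score a n S v = s.real 3 0 0 ∧ -1 < s.real 3 0 0 ∧
      ∀ i < n, ∀ k : Fin K, s.real 1 i k = X.left a k n S v i ∧ s.real 2 k i = X.right a k n S v i

/-- Nested loops over the first `j` parameters. -/
def nest (B : Program) : ℕ → Program
  | 0 => B
  | j + 1 => .loop (j + 2) 0 (nest B j)

/-- The body of the search: try the candidate given by the constants `a` and the parameters in the
registers. -/
theorem exists_body (a : α) : ∃ (B : Program) (T : Polynomial ℕ), ∀ n S s, X.Inv n S s →
    (∀ i, s.nat (paramReg d i) < n) →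
    X.Inv n S (B.exec s).1 ∧ (∀ x < d + 2, (B.exec s).1.nat x = s.nat x) ∧
    s.real 3 0 0 ≤ (B.exec s).1.real 3 0 0 ∧
    X.score a n S (fun i => s.nat (paramReg d i)) ≤ (B.exec s).1.real 3 0 0 ∧
    (B.exec s).2 ≤ T.eval n := by
  obtain ⟨P, T, hP⟩ := X.score_computable a
  choose Q U hQ using X.left_computable a
  choose Q' U' hQ' using X.right_computable a
  let ρ : Fin d → ℕ := paramReg d
  have hρ : ∀ i, ρ i < d + 4 := fun i => by have := i.2; simp only [ρ, paramReg]; omega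
  let ρ' : Option (Fin d) → ℕ := PolyComputable.cons (d + 2) ρ
  have hρ' : ∀ i, ρ' i < d + 4 := by
    rintro (_ | i)
    · change d + 2 < d + 4; omega
    · exact hρ i
  have hkey : ∀ (F : Fin K → ℕ → (ℕ → ℕ → ℝ) → (Fin d → ℕ) → ℕ → ℝ)
      (q : Fin K → (Option (Fin d) → ℕ) → ℕ → Program) (u : Fin K → Polynomial ℕ)
      (_ : ∀ k ρ l, 4 ≤ l → (∀ i, ρ i < l) → ∀ n S s, Holds n S s → Evaluates (q k ρ l) l
        (F k n S (fun i => s.nat (ρ (some i))) (s.nat (ρ none))) ((u k).eval n) s) n S,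
      ∀ j s, Holds n S s → Evaluates (q j ρ' (d + 4)) (d + 4)
        (F j n S (fun i => s.nat (paramReg d i)) (s.nat (d + 2)))
        ((∑ k, u k).eval n) s := by
    intro F q u h n S j s hs
    have := h j ρ' (d + 4) (by omega) hρ' n S s hs
    refine ⟨this.agree, this.value, this.steps.trans ?_⟩
    rw [Polynomial.eval_finsetSum]
    exact Finset.single_le_sum (f := fun k => (u k).eval n) (fun _ _ => Nat.zero_le _)
      (Finset.mem_univ j)
  let O1 := fillColumns false d 1 (fun j => Q j ρ' (d + 4)) (List.finRange K)
  let O2 := fillColumns true d 2 (fun j => Q' j ρ' (d + 4)) (List.finRange K)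
  let W : Program := .seq (.realCopy (cell 3) (cell (d + 4))) (.seq O1 O2)
  let B : Program := .seq (P ρ (d + 4)) (.ifReal (cell (d + 4)) (cell 3) .skip W)
  let C : Polynomial ℕ → Polynomial ℕ := fun t => 1 + (K : Polynomial ℕ) * (2 + Polynomial.X * (2 + t))
  refine ⟨B, T + (1 + (1 + (C (∑ k, U k) + C (∑ k, U' k)))), fun n S s hI hlt => ?_⟩
  have hs := hI.holds
  have h1 := hP ρ (d + 4) (by omega) hρ n S s hs
  set s1 := ((P ρ (d + 4)).exec s).1 with e1
  have hs1 := hs.of_agree (by omega) h1.agree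
  set v : Fin d → ℕ := fun i => s.nat (paramReg d i) with hv
  have c1 : s1.get (cell (d + 4)) = X.score a n S v := by rw [get_cell hs1.zero, h1.value]
  have c2 : s1.get (cell 3) = s.real 3 0 0 := by
    rw [get_cell hs1.zero, h1.agree.real 3 (by omega)]
  have hC : ∀ t, (C t).eval n = 1 + K * (2 + n * (2 + t.eval n)) := by
    intro t
    simp only [C, Polynomial.eval_add, Polynomial.eval_one, Polynomial.eval_mul,
      Polynomial.eval_X, Polynomial.eval_natCast, Polynomial.eval_ofNat]
    simp
  have st1 := h1.steps
  by_cases hc : X.score a n S v ≤ s.real 3 0 0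
  · have ex : B.exec s = (s1, ((P ρ (d + 4)).exec s).2 + (1 + 1)) := by
      simp only [B, Program.exec, ← e1, c1, c2, hc, if_true]
    rw [ex]
    have r1 : s1.real 1 = s.real 1 := h1.agree.real 1 (by omega)
    have r2 : s1.real 2 = s.real 2 := h1.agree.real 2 (by omega)
    have r3 : s1.real 3 = s.real 3 := h1.agree.real 3 (by omega)
    refine ⟨⟨hs1, ?_⟩, fun x hx => h1.agree.nat x (by omega), ?_, ?_, ?_⟩
    · simp only [r1, r2, r3]; exact hI.found
    · simp only [r3, le_refl]
    · simp only [r3]; exact hc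
    · simp only [Polynomial.eval_add, Polynomial.eval_one, hC]; omega
  · set s2 := s1.set (cell 3) (s1.get (cell (d + 4))) with e2
    have ha2 : AgreeOff d {1, 2, 3} s s2 := (h1.agree.agreeOff _).trans
      ⟨fun _ _ => rfl, fun b _ hb => set_real_of_ne _ _ _ (by
        simp only [cell]; rintro rfl; simp at hb)⟩
    have hs2 := hs.of_agreeOff (by simp) ha2
    have hp : ∀ {t : State} {V : Set ℕ}, AgreeOff d V s t →
        (fun i => t.nat (paramReg d i)) = v := fun h =>
      funext fun p => h.nat _ (by have := p.2; simp only [paramReg]; omega)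
    obtain ⟨f1, f2, -, f4⟩ := fillColumns_spec (tr := false) (arr := 1)
      (F := fun j => X.left a j n S) (by omega) (by omega)
      (hkey (fun j => X.left a j) Q U hQ n S) (List.finRange K) hs2
    set s3 := (O1.exec s2).1 with e3
    have ha3 := ha2.trans (f1.mono (W' := {1, 2, 3}) (by simp))
    have hs3 := hs.of_agreeOff (by simp) ha3
    obtain ⟨g1, g2, -, g4⟩ := fillColumns_spec (tr := true) (arr := 2)
      (F := fun j => X.right a j n S) (by omega) (by omega)
      (hkey (fun j => X.right a j) Q' U' hQ' n S) (List.finRange K) hs3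
    set s4 := (O2.exec s3).1 with e4
    have ha4 := ha3.trans (g1.mono (W' := {1, 2, 3}) (by simp))
    have hs4 := hs.of_agreeOff (by simp) ha4
    have ex : B.exec s = (s4, ((P ρ (d + 4)).exec s).2 +
        (1 + (1 + ((O1.exec s2).2 + (O2.exec s3).2)))) := by
      simp only [B, W, Program.exec, ← e1, c1, c2, hc, if_false]
      rw [← c1]
    rw [ex]
    have b3 : s4.real 3 0 0 = X.score a n S v := by
      rw [g1.real 3 (by omega) (by simp), f1.real 3 (by omega) (by simp), e2,
        set_cell_real hs1.zero, c1]
    have hm : s.real 3 0 0 < s4.real 3 0 0 := by rw [b3]; exact not_le.1 hc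
    refine ⟨⟨hs4, Or.inr ⟨a, v, hlt, b3.symm, ?_, fun i hi k => ⟨?_, ?_⟩⟩⟩,
      fun x hx => ha4.nat x hx, hm.le, b3.ge, ?_⟩
    · refine lt_of_le_of_lt ?_ hm
      rcases hI.found with h | ⟨_, _, _, _, h, _⟩
      · exact h.1.ge
      · exact h.le
    · have := f2 i hi k (List.mem_finRange k)
      simp only [hp ha2] at this
      rw [← this]
      change s4.real 1 i k = s3.real 1 i k
      rw [g1.real 1 (by omega) (by simp)]
    · have := g2 i hi k (List.mem_finRange k)
      simp only [hp ha3] at this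
      rw [← this]
      rfl
    · simp only [List.length_finRange] at f4 g4
      simp only [Polynomial.eval_add, Polynomial.eval_one, hC]
      have f4' : (O1.exec s2).2 ≤ _ := f4
      have g4' : (O2.exec s3).2 ≤ _ := g4
      omega

theorem nest_spec (a : α) {B : Program} {T : Polynomial ℕ}
    (hB : ∀ n S s, X.Inv n S s → (∀ i, s.nat (paramReg d i) < n) →
      X.Inv n S (B.exec s).1 ∧ (∀ x < d + 2, (B.exec s).1.nat x = s.nat x) ∧
      s.real 3 0 0 ≤ (B.exec s).1.real 3 0 0 ∧
      X.score a n S (fun i => s.nat (paramReg d i)) ≤ (B.exec s).1.real 3 0 0 ∧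
      (B.exec s).2 ≤ T.eval n) (j : ℕ) (hj : j ≤ d) :
    ∃ T' : Polynomial ℕ, ∀ n S s, X.Inv n S s →
      (∀ i : Fin d, j ≤ i → s.nat (paramReg d i) < n) →
      X.Inv n S ((nest B j).exec s).1 ∧
      (∀ x < d + 2, j + 2 ≤ x → ((nest B j).exec s).1.nat x = s.nat x) ∧
      s.real 3 0 0 ≤ ((nest B j).exec s).1.real 3 0 0 ∧
      (∀ v : Fin d → ℕ, (∀ i, v i < n) → (∀ i : Fin d, j ≤ i → v i = s.nat (paramReg d i)) →
        X.score a n S v ≤ ((nest B j).exec s).1.real 3 0 0) ∧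
      ((nest B j).exec s).2 ≤ T'.eval n := by
  induction j with
  | zero =>
    refine ⟨T, fun n S s hs hlt => ?_⟩
    obtain ⟨h1, h2, h3, h4, h5⟩ := hB n S s hs fun i => hlt i (Nat.zero_le _)
    refine ⟨h1, fun x hx _ => h2 x hx, h3, fun v _ hv => ?_, h5⟩
    obtain rfl : v = fun i => s.nat (paramReg d i) := funext fun i => hv i (Nat.zero_le _)
    exact h4
  | succ j ih =>
    obtain ⟨T', ih⟩ := ih (by omega)
    refine ⟨1 + Polynomial.X * (1 + T'), fun n S s hs hlt => ?_⟩
    have key := rounds_induction (f := (nest B j).exec) (x := j + 2) (s := s) (N := n)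
      (t := T'.eval n)
      (fun i r => X.Inv n S r ∧ (∀ x < d + 2, j + 1 + 2 ≤ x → r.nat x = s.nat x) ∧
        s.real 3 0 0 ≤ r.real 3 0 0 ∧
        ∀ v : Fin d → ℕ, (∀ i, v i < n) → v ⟨j, hj⟩ < i →
          (∀ i : Fin d, j + 1 ≤ i → v i = s.nat (paramReg d i)) →
          X.score a n S v ≤ r.real 3 0 0)
      ⟨hs, fun _ _ _ => rfl, le_rfl, by simp⟩ (by
        rintro i hi r ⟨r1, r2, r3, r4⟩
        set r0 := r.setNat (j + 2) i with er
        have hr0 : X.Inv n S r0 := by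
          refine ⟨⟨?_, ?_, r1.holds.data⟩, r1.found⟩
          · exact (setNat_nat_of_ne _ _ (by omega)).trans r1.holds.size
          · exact (setNat_nat_of_ne _ _ (by omega)).trans r1.holds.zero
        have hn : ∀ l : Fin d, j + 1 ≤ l → r0.nat (paramReg d l) = s.nat (paramReg d l) := by
          intro l hl
          have := l.2
          rw [er, setNat_nat_of_ne _ _ (by simp only [paramReg]; omega),
            r2 _ (by simp only [paramReg]; omega) (by simp only [paramReg]; omega)]
        have hnj : r0.nat (paramReg d ⟨j, hj⟩) = i := setNat_nat_self _ _ _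
        obtain ⟨q1, q2, q3, q4, q5⟩ := ih n S r0 hr0 (by
          intro l hl
          rcases hl.eq_or_lt with h | h
          · obtain rfl : l = ⟨j, hj⟩ := Fin.ext h.symm
            rwa [hnj]
          · rw [hn l h]; exact hlt l h)
        refine ⟨⟨q1, ?_, r3.trans q3, ?_⟩, q5⟩
        · intro x hx hx'
          rw [q2 x hx (by omega), er, setNat_nat_of_ne _ _ (by omega), r2 x hx hx']
        · intro v hv hvj hvs
          rcases (Nat.lt_succ_iff.1 hvj).eq_or_lt with h | h
          · refine q4 v hv fun l hl => ?_
            rcases hl.eq_or_lt with h' | h'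
            · obtain rfl : l = ⟨j, hj⟩ := Fin.ext h'.symm
              rw [hnj, h]
            · rw [hn l h', hvs l h']
          · exact (r4 v hv h hvs).trans q3)
    have hn : s.nat 0 = n := hs.holds.size
    have ex : (nest B (j + 1)).exec s = ((rounds (nest B j).exec (j + 2) s n).1,
        1 + (rounds (nest B j).exec (j + 2) s n).2) := by
      rw [← hn]; rfl
    rw [ex]
    obtain ⟨⟨k1, k2, k3, k4⟩, k5⟩ := key
    refine ⟨k1, k2, k3, fun v hv hvs => k4 v hv (hv _) hvs, ?_⟩
    simp only [Polynomial.eval_add, Polynomial.eval_one, Polynomial.eval_mul, Polynomial.eval_X]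
    omega

/-- The search over a finite list of constants. -/
theorem exists_search (c : List α) : ∃ (A : Program) (T : Polynomial ℕ), ∀ n S s, X.Inv n S s →
    X.Inv n S (A.exec s).1 ∧ s.real 3 0 0 ≤ (A.exec s).1.real 3 0 0 ∧
    (∀ a ∈ c, ∀ v, (∀ i, v i < n) → X.score a n S v ≤ (A.exec s).1.real 3 0 0) ∧
    (A.exec s).2 ≤ T.eval n := by
  induction c with
  | nil => exact ⟨.skip, 1, fun n S s hs => ⟨hs, le_rfl, by simp, by simp [Program.exec]⟩⟩
  | cons a c ih =>
    obtain ⟨A, T, hA⟩ := ih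
    obtain ⟨B, U, hB⟩ := X.exists_body a
    obtain ⟨U', hU'⟩ := X.nest_spec a hB d le_rfl
    refine ⟨.seq (nest B d) A, U' + T, fun n S s hs => ?_⟩
    obtain ⟨h1, -, h3, h4, h5⟩ := hU' n S s hs fun i hi => absurd i.2 (by omega)
    obtain ⟨g1, g2, g3, g4⟩ := hA n S _ h1
    refine ⟨g1, h3.trans g2, ?_, ?_⟩
    · intro b hb v hv
      rcases List.mem_cons.1 hb with rfl | hb
      · exact (h4 v hv fun i hi => absurd i.2 (by omega)).trans g2
      · exact g3 b hb v hv
    · rw [Polynomial.eval_add]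
      exact add_le_add h5 g4

/-- The entries of a matrix, extended by zero. -/
noncomputable def _root_.Matrix.extendZero {n : ℕ} (S : Matrix (Fin n) (Fin n) ℝ) (i j : ℕ) : ℝ :=
  if h : i < n ∧ j < n then S ⟨i, h.1⟩ ⟨j, h.2⟩ else 0

/-- A polynomial-time program that outputs a candidate of maximal score, if some score exceeds
`-1`, and zero matrices otherwise. -/
theorem exists_program (c : List α) : ∃ A : Program, A.PolyTime ∧
    ∀ (n : ℕ) (S : Matrix (Fin n) (Fin n) ℝ),
      (A.leftFactor K S = 0 ∧ A.rightFactor K S = 0 ∧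
        ∀ a ∈ c, ∀ v, (∀ i, v i < n) → X.score a n S.extendZero v ≤ -1) ∨
      ∃ a v, (∀ i, v i < n) ∧ -1 < X.score a n S.extendZero v ∧
        (∀ i k, A.leftFactor K S i k = X.left a k n S.extendZero v i) ∧
        (∀ k i, A.rightFactor K S k i = X.right a k n S.extendZero v i) ∧
        ∀ a' ∈ c, ∀ v', (∀ i, v' i < n) →
          X.score a' n S.extendZero v' ≤ X.score a n S.extendZero v := by
  obtain ⟨A, T, hA⟩ := X.exists_search c
  have hinit : ∀ (n : ℕ) (S : Matrix (Fin n) (Fin n) ℝ),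
      X.Inv n S.extendZero ((input S).set (cell 3) ((-1 : ℚ) : ℝ)) := by
    intro n S
    refine ⟨⟨rfl, rfl, ?_⟩, Or.inl ⟨?_, ?_, ?_⟩⟩
    · rw [set_real_of_ne _ _ _ (by simp [cell])]
      funext i j
      simp [input, Matrix.extendZero]
    · rw [set_cell_real (by simp [input])]; simp
    · rw [set_real_of_ne _ _ _ (by simp [cell])]
      funext i j
      simp [input]
    · rw [set_real_of_ne _ _ _ (by simp [cell])]
      funext i j
      simp [input]
  refine ⟨.seq (.realConst (cell 3) (-1)) A, ⟨1 + T, fun n S => ?_⟩, fun n S => ?_⟩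
  · have := (hA n _ _ (hinit n S)).2.2.2
    rw [Polynomial.eval_add, Polynomial.eval_one]
    exact Nat.add_le_add_left this 1
  · obtain ⟨h1, -, h3, -⟩ := hA n _ _ (hinit n S)
    set s := (A.exec ((input S).set (cell 3) ((-1 : ℚ) : ℝ))).1 with es
    rcases h1.found with ⟨f1, f2, f3⟩ | ⟨a, v, hv, f1, f2, f3⟩
    · left
      refine ⟨?_, ?_, fun a ha v hv => (h3 a ha v hv).trans f1.le⟩
      · funext i j; change s.real 1 i j = 0; rw [f2]; rfl
      · funext i j; change s.real 2 i j = 0; rw [f3]; rfl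
    · right
      refine ⟨a, v, hv, f1 ▸ f2, fun i k => (f3 i i.2 k).1, fun k i => (f3 i i.2 k).2, ?_⟩
      intro a' ha' v' hv'
      rw [f1]; exact h3 a' ha' v' hv'

end SearchProblem

end RealRAM

open Finset in
/-- Every box has finite rational grids of arbitrarily small mesh. -/
theorem exists_grid (ι : Type*) [Fintype ι] (B : ℕ) {δ : ℝ} (hδ : 0 < δ) :
    ∃ G : List (ι → ℚ), (∀ g ∈ G, ∀ i, 0 ≤ g i ∧ g i ≤ B) ∧
      ∀ x : ι → ℝ, (∀ i, 0 ≤ x i ∧ x i ≤ B) → ∃ g ∈ G, ∀ i, |x i - g i| ≤ δ := by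
  classical
  obtain ⟨L, hL⟩ := exists_nat_one_div_lt hδ
  have hL0 : (0 : ℝ) < L + 1 := by positivity
  have hL0' : (0 : ℚ) < L + 1 := by positivity
  refine ⟨(Fintype.piFinset fun _ : ι =>
    (range (B * (L + 1) + 1)).image fun j : ℕ => (j : ℚ) / (L + 1)).toList, ?_, ?_⟩
  · intro g hg i
    rw [mem_toList, Fintype.mem_piFinset] at hg
    obtain ⟨j, hj, hji⟩ := mem_image.1 (hg i)
    rw [← hji]
    refine ⟨by positivity, ?_⟩
    rw [div_le_iff₀ hL0']
    have := Nat.lt_succ_iff.1 (mem_range.1 hj)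
    exact_mod_cast this
  · intro x hx
    refine ⟨fun i => (⌊x i * (L + 1)⌋₊ : ℚ) / (L + 1), ?_, fun i => ?_⟩
    · rw [mem_toList, Fintype.mem_piFinset]
      intro i
      refine mem_image.2 ⟨_, ?_, rfl⟩
      rw [mem_range, Nat.lt_succ_iff]
      refine Nat.floor_le_of_le ?_
      push_cast
      exact mul_le_mul_of_nonneg_right (hx i).2 hL0.le
    · have h1 := Nat.floor_le (mul_nonneg (hx i).1 hL0.le)
      have h2 := Nat.lt_floor_add_one (x i * (L + 1))
      have h3 : x i - ((⌊x i * (L + 1)⌋₊ : ℚ) / (L + 1) : ℚ) =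
          (x i * (L + 1) - ⌊x i * (L + 1)⌋₊) * (1 / (L + 1)) := by
        push_cast; field_simp
      rw [h3, abs_of_nonneg (mul_nonneg (by linarith) (by positivity))]
      refine le_trans ?_ hL.le
      exact mul_le_of_le_one_left (by positivity) (by linarith)

/-- The unit cube can be divided into finitely many classes of small diameter. -/
theorem exists_classes (K : ℕ) {δ : ℝ} (hδ : 0 < δ) :
    ∃ (N : ℕ) (cls : (Fin K → ℝ) → Fin N), ∀ x y, (∀ i, 0 ≤ x i ∧ x i ≤ 1) →
      (∀ i, 0 ≤ y i ∧ y i ≤ 1) → cls x = cls y → ∀ i, |x i - y i| ≤ δ := by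
  obtain ⟨G, -, hG⟩ := exists_grid (Fin K) 1 (half_pos hδ)
  simp only [Nat.cast_one] at hG
  have h : ∀ x : Fin K → ℝ, ∃ j : Fin G.length, (∀ i, 0 ≤ x i ∧ x i ≤ 1) →
      ∀ i, |x i - (G.get j) i| ≤ δ / 2 := by
    intro x
    by_cases hx : ∀ i, 0 ≤ x i ∧ x i ≤ 1
    · obtain ⟨g, hg, hgx⟩ := hG x hx
      obtain ⟨j, rfl⟩ := List.mem_iff_get.1 hg
      exact ⟨j, fun _ => hgx⟩
    · obtain ⟨g, hg, -⟩ := hG 0 (by simp)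
      obtain ⟨j, -⟩ := List.mem_iff_get.1 hg
      exact ⟨j, fun h => absurd h hx⟩
  choose cls hcls using h
  refine ⟨G.length, cls, fun x y hx hy hxy i => ?_⟩
  have h1 := hcls x hx i
  have h2 := hcls y hy i
  rw [← hxy, abs_sub_comm] at h2
  have h3 := abs_sub_le (x i) ((G.get (cls x) i : ℚ) : ℝ) (y i)
  linarith

/-! ### Compression of the columns -/

section Compression

open Finset

variable {K N n : ℕ} {V : Fin K → ℕ → ℝ} {cl : ℕ → Fin N} {δ : ℝ}

/-- The columns of `V` are summed over each class. -/
def classSum (n : ℕ) (V : Fin K → ℕ → ℝ) (cl : ℕ → Fin N) (k : Fin K) (b : Fin N) : ℝ :=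
  ∑ z ∈ range n with cl z = b, V k z

/-- The total weight of the columns of a class. -/
def classMass (n : ℕ) (V : Fin K → ℕ → ℝ) (cl : ℕ → Fin N) (b : Fin N) : ℝ :=
  ∑ z ∈ range n with cl z = b, ∑ k, V k z

theorem classSum_nonneg (hV : ∀ k z, 0 ≤ V k z) (k : Fin K) (b : Fin N) :
    0 ≤ classSum n V cl k b :=
  sum_nonneg fun _ _ => hV _ _

theorem classMass_nonneg (hV : ∀ k z, 0 ≤ V k z) (b : Fin N) : 0 ≤ classMass n V cl b :=
  sum_nonneg fun _ _ => sum_nonneg fun _ _ => hV _ _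

theorem sum_classSum (k : Fin K) : ∑ b, classSum n V cl k b = ∑ z ∈ range n, V k z :=
  sum_fiberwise _ _ _

theorem sum_classMass : ∑ b, classMass n V cl b = ∑ z ∈ range n, ∑ k, V k z :=
  sum_fiberwise _ _ _

theorem eq_zero_of_classMass (hV : ∀ k z, 0 ≤ V k z) {b : Fin N} (h : classMass n V cl b = 0)
    (k : Fin K) {z : ℕ} (hz : z ∈ (range n).filter fun z => cl z = b) : V k z = 0 := by
  have h1 := (sum_eq_zero_iff_of_nonneg fun z _ => sum_nonneg fun k _ => hV k z).1 h z hz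
  exact (sum_eq_zero_iff_of_nonneg fun k _ => hV k z).1 h1 k (mem_univ k)

theorem abs_mul_classMass_sub_le
    (hcl : ∀ z z', cl z = cl z' → ∀ k,
      |V k z * ∑ l, V l z' - V k z' * ∑ l, V l z| ≤ δ * (∑ l, V l z) * ∑ l, V l z')
    (z : ℕ) (k : Fin K) :
    |V k z * classMass n V cl (cl z) - classSum n V cl k (cl z) * ∑ l, V l z| ≤
      δ * (∑ l, V l z) * classMass n V cl (cl z) := by
  rw [classMass, classSum, mul_sum, sum_mul, mul_sum, ← sum_sub_distrib]
  refine (abs_sum_le_sum_abs _ _).trans (sum_le_sum fun z' hz' => ?_)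
  exact hcl z z' (mem_filter.1 hz').2.symm k

theorem sum_abs_le_sum_abs_classSum (hV : ∀ k z, 0 ≤ V k z)
    (hcl : ∀ z z', cl z = cl z' → ∀ k,
      |V k z * ∑ l, V l z' - V k z' * ∑ l, V l z| ≤ δ * (∑ l, V l z) * ∑ l, V l z')
    (x : Fin K → ℝ) :
    ∑ z ∈ range n, |∑ k, x k * V k z| ≤
      ∑ b, |∑ k, x k * classSum n V cl k b| +
        δ * (∑ k, |x k|) * ∑ z ∈ range n, ∑ k, V k z := by
  rw [← sum_classMass (cl := cl), mul_sum, ← sum_add_distrib, ← sum_fiberwise (range n) cl]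
  refine sum_le_sum fun b _ => ?_
  rcases (classMass_nonneg (n := n) (cl := cl) hV b).eq_or_lt with h0 | h0
  · have : ∑ z ∈ range n with cl z = b, |∑ k, x k * V k z| = 0 := by
      refine sum_eq_zero fun z hz => ?_
      simp [eq_zero_of_classMass hV h0.symm _ hz]
    rw [this, ← h0]
    simp
  · refine le_of_mul_le_mul_right ?_ h0
    rw [sum_mul]
    calc ∑ z ∈ range n with cl z = b, |∑ k, x k * V k z| * classMass n V cl b
        ≤ ∑ z ∈ range n with cl z = b, ((|∑ k, x k * classSum n V cl k b| +
          δ * (∑ k, |x k|) * classMass n V cl b) * ∑ l, V l z) := by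
          refine sum_le_sum fun z hz => ?_
          obtain rfl := (mem_filter.1 hz).2
          have hv : 0 ≤ ∑ l, V l z := sum_nonneg fun _ _ => hV _ _
          have e1 : |∑ k, x k * V k z| * classMass n V cl (cl z) =
              |(∑ k, x k * classSum n V cl k (cl z)) * (∑ l, V l z) +
                ∑ k, x k * (V k z * classMass n V cl (cl z) -
                  classSum n V cl k (cl z) * ∑ l, V l z)| := by
            rw [← abs_of_pos h0, ← abs_mul, abs_of_pos h0]
            congr 1
            rw [sum_mul, sum_mul, ← sum_add_distrib]
            exact sum_congr rfl fun k _ => by ring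
          rw [e1]
          refine (abs_add_le _ _).trans ?_
          rw [abs_mul, abs_of_nonneg hv, add_mul]
          refine add_le_add le_rfl ((abs_sum_le_sum_abs _ _).trans ?_)
          rw [show δ * (∑ k, |x k|) * classMass n V cl (cl z) * ∑ l, V l z =
            ∑ k, |x k| * (δ * (∑ l, V l z) * classMass n V cl (cl z)) by rw [← sum_mul]; ring]
          refine sum_le_sum fun k _ => ?_
          rw [abs_mul]
          exact mul_le_mul_of_nonneg_left
            (abs_mul_classMass_sub_le (n := n) hcl z k) (abs_nonneg (x k))
      _ = _ := by rw [← mul_sum]; rfl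

/-- Some column of each class, suitably scaled, is close to the sum of the columns of the class,
also in presence of noise. -/
theorem exists_representative (hn : 0 < n) (hV : ∀ k z, 0 ≤ V k z)
    (hcl : ∀ z z', cl z = cl z' → ∀ k,
      |V k z * ∑ l, V l z' - V k z' * ∑ l, V l z| ≤ δ * (∑ l, V l z) * ∑ l, V l z')
    {A : ℕ → Fin K → ℝ} (hA : ∀ w k, 0 ≤ A w k) (S : ℕ → ℕ → ℝ) (b : Fin N) :
    ∃ z < n, ∃ t : ℝ, 0 ≤ t ∧ ∑ w ∈ range n, |t * S w z - ∑ k, A w k * classSum n V cl k b| ≤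
      (∑ z ∈ range n with cl z = b, ∑ w ∈ range n, |S w z - ∑ k, A w k * V k z|) +
        (∑ w ∈ range n, ∑ k, A w k) * δ * classMass n V cl b := by
  set E : ℕ → ℝ := fun z => ∑ w ∈ range n, |S w z - ∑ k, A w k * V k z| with hE
  have hE0 : ∀ z, 0 ≤ E z := fun z => sum_nonneg fun _ _ => abs_nonneg _
  rcases (classMass_nonneg (n := n) (cl := cl) hV b).eq_or_lt with h0 | h0
  · refine ⟨0, hn, 0, le_rfl, ?_⟩
    have : ∀ k, classSum n V cl k b = 0 := fun k =>
      sum_eq_zero fun z hz => eq_zero_of_classMass hV h0.symm k hz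
    simp only [this, ← h0]
    simp only [zero_mul, mul_zero, sum_const_zero, sub_zero, abs_zero, add_zero]
    exact sum_nonneg fun z _ => hE0 z
  · set s := (range n).filter fun z => cl z = b with hs
    set s' := s.filter fun z => 0 < ∑ l, V l z with hs'
    have hvs : ∑ z ∈ s', ∑ l, V l z = classMass n V cl b := by
      rw [hs', sum_filter_of_ne]
      · rfl
      · intro z _ hz
        exact lt_of_le_of_ne (sum_nonneg fun _ _ => hV _ _) hz.symm
    have hne : s'.Nonempty := by
      rw [nonempty_iff_ne_empty]
      intro h
      rw [h, sum_empty] at hvs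
      exact h0.ne hvs
    obtain ⟨z, hz, hle⟩ := exists_le_of_sum_le hne
      (f := fun z => classMass n V cl b * E z) (g := fun z => (∑ l, V l z) * ∑ z ∈ s, E z) (by
        rw [← sum_mul, ← mul_sum, hvs]
        exact mul_le_mul_of_nonneg_left
          (sum_le_sum_of_subset_of_nonneg (filter_subset _ _) fun z _ _ => hE0 z) h0.le)
    obtain ⟨hzs, hv⟩ := mem_filter.1 hz
    obtain ⟨hzn, rfl⟩ := mem_filter.1 hzs
    set v := ∑ l, V l z with hvdef
    set M := classMass n V cl (cl z) with hM
    refine ⟨z, mem_range.1 hzn, M / v, by positivity, ?_⟩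
    have h1 : ∀ k, |M / v * V k z - classSum n V cl k (cl z)| ≤ δ * M := by
      intro k
      have := abs_mul_classMass_sub_le (n := n) hcl z k
      rw [← hvdef, ← hM] at this
      have e : M / v * V k z - classSum n V cl k (cl z) =
          (V k z * M - classSum n V cl k (cl z) * v) / v := by field_simp
      rw [e, abs_div, abs_of_pos hv, div_le_iff₀ hv]
      linarith
    calc ∑ w ∈ range n, |M / v * S w z - ∑ k, A w k * classSum n V cl k (cl z)|
        ≤ ∑ w ∈ range n, (M / v * |S w z - ∑ k, A w k * V k z| + ∑ k, A w k * (δ * M)) := by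
          refine sum_le_sum fun w _ => ?_
          have e : M / v * S w z - ∑ k, A w k * classSum n V cl k (cl z) =
              M / v * (S w z - ∑ k, A w k * V k z) +
                ∑ k, A w k * (M / v * V k z - classSum n V cl k (cl z)) := by
            rw [mul_sub, mul_sum]
            simp only [mul_sub, sum_sub_distrib]
            have : ∑ k, A w k * (M / v * V k z) = ∑ k, M / v * (A w k * V k z) :=
              sum_congr rfl fun _ _ => by ring
            linarith
          rw [e]
          refine (abs_add_le _ _).trans (add_le_add ?_ ((abs_sum_le_sum_abs _ _).trans ?_))
          · rw [abs_mul, abs_of_nonneg (by positivity)]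
          · refine sum_le_sum fun k _ => ?_
            rw [abs_mul, abs_of_nonneg (hA w k)]
            exact mul_le_mul_of_nonneg_left (h1 k) (hA w k)
      _ = M / v * E z + (∑ w ∈ range n, ∑ k, A w k) * δ * M := by
          rw [sum_add_distrib, ← mul_sum]
          congr 1
          simp only [← sum_mul]
          ring
      _ ≤ _ := by
          refine add_le_add ?_ le_rfl
          rw [div_mul_eq_mul_div, div_le_iff₀ hv]
          linarith

theorem sum_abs_normalize_sub_le (s : Finset ℕ) (x y : ℕ → ℝ) {t D : ℝ} (μ : ℝ) (ht : 0 ≤ t)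
    (h : ∑ w ∈ s, |t * x w - y w| ≤ D) :
    ∑ w ∈ s, |μ * x w / ∑ w ∈ s, |x w| - y w| ≤ 2 * D + |∑ w ∈ s, |y w| - μ| := by
  set X := ∑ w ∈ s, |x w| with hX
  have hX0 : 0 ≤ X := sum_nonneg fun _ _ => abs_nonneg _
  have hD : 0 ≤ D := (sum_nonneg fun _ _ => abs_nonneg _).trans h
  rcases hX0.eq_or_lt with h0 | h0
  · have hx : ∀ w ∈ s, x w = 0 := fun w hw =>
      abs_eq_zero.1 ((sum_eq_zero_iff_of_nonneg fun _ _ => abs_nonneg _).1 h0.symm w hw)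
    have : ∑ w ∈ s, |μ * x w / X - y w| = ∑ w ∈ s, |t * x w - y w| :=
      sum_congr rfl fun w hw => by rw [hx w hw]; simp
    rw [this]
    have := abs_nonneg (∑ w ∈ s, |y w| - μ)
    linarith
  · have h1 : ∑ w ∈ s, |μ * x w / X - y w| ≤ |μ - t * X| + D := by
      calc ∑ w ∈ s, |μ * x w / X - y w|
          ≤ ∑ w ∈ s, (|μ / X - t| * |x w| + |t * x w - y w|) := by
            refine sum_le_sum fun w _ => ?_
            have e : μ * x w / X - y w = (μ / X - t) * x w + (t * x w - y w) := by ring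
            rw [e, ← abs_mul]
            exact abs_add_le _ _
        _ = |μ / X - t| * X + ∑ w ∈ s, |t * x w - y w| := by
            rw [sum_add_distrib, ← mul_sum]
        _ ≤ |μ - t * X| + D := by
            refine add_le_add (le_of_eq ?_) h
            rw [← abs_of_pos h0, ← abs_mul, abs_of_pos h0]
            congr 1
            field_simp
    have h2 : |t * X - (∑ w ∈ s, |y w|)| ≤ D := by
      rw [hX, mul_sum, ← sum_sub_distrib]
      refine (abs_sum_le_sum_abs _ _).trans ((sum_le_sum fun w _ => ?_).trans h)
      have := abs_abs_sub_abs_le (t * x w) (y w)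
      rwa [abs_mul, abs_of_nonneg ht] at this
    have h3 := abs_sub_le μ (∑ w ∈ s, |y w|) (t * X)
    rw [abs_sub_comm μ (∑ w ∈ s, |y w|), abs_sub_comm (∑ w ∈ s, |y w|) (t * X)] at h3
    linarith

end Compression

/-! ### The candidates -/

/-- The constants of a candidate: the weights `mass` and the profiles `profile` of the classes of
columns, and whether the candidate has prescribed anchor rows. -/
structure FitConstants (K N : ℕ) where
  mass : Fin N → ℚ
  profile : Fin K → Fin N → ℚ
  anchored : Bool

namespace FitConstants

open Finset RealRAM

variable {K N : ℕ}

noncomputable def rowMass (n : ℕ) (S : ℕ → ℕ → ℝ) (w : ℕ) : ℝ := ∑ z ∈ range n, |S w z|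

noncomputable def colMass (n : ℕ) (S : ℕ → ℕ → ℝ) (z : ℕ) : ℝ := ∑ w ∈ range n, |S w z|

variable (c : FitConstants K N) (G : List (Fin K → ℚ)) (n : ℕ) (S : ℕ → ℕ → ℝ)
  (rep : Fin N → ℕ) (anchor : Fin K → ℕ)

/-- The column representing class `b`, scaled to the weight of the class. -/
noncomputable def compressed (w : ℕ) (b : Fin N) : ℝ :=
  c.mass b * S w (rep b) / colMass n S (rep b)

noncomputable def rowCost (w : ℕ) (g : Fin K → ℚ) : ℝ :=
  ∑ b, |c.compressed n S rep w b - ∑ k, rowMass n S w * g k * c.profile k b|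

/-- The unnormalised left factor: every row is fitted on the compressed matrix, except for the
prescribed anchor rows. -/
noncomputable def rawLeft (w : ℕ) (k : Fin K) : ℝ :=
  if c.anchored ∧ ∃ j ∈ univ.erase k, w = anchor j then 0
  else if c.anchored ∧ w = anchor k then rowMass n S w
  else rowMass n S w * PolyComputable.minimizer (c.rowCost n S rep w) 0 G k

noncomputable def topicMass (k : Fin K) : ℝ := ∑ w ∈ range n, c.rawLeft G n S rep anchor w k

noncomputable def left (w : ℕ) (k : Fin K) : ℝ :=
  c.rawLeft G n S rep anchor w k / c.topicMass G n S rep anchor k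

noncomputable def colCost (z : ℕ) (h : Fin K → ℚ) : ℝ :=
  ∑ w ∈ range n, |S w z - ∑ k, c.left G n S rep anchor w k * (colMass n S z * h k)|

noncomputable def right (k : Fin K) (z : ℕ) : ℝ :=
  colMass n S z * PolyComputable.minimizer (c.colCost G n S rep anchor z) 0 G k

noncomputable def residual : ℝ :=
  ∑ z ∈ range n, ∑ w ∈ range n,
    |S w z - ∑ k, c.left G n S rep anchor w k * c.right G n S rep anchor k z|

/-- The weight of anchor row `k`, and `1` for `none`. -/
noncomputable def anchorWeight : Option (Fin K) → ℝ
  | none => 1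
  | some k => c.left G n S rep anchor (anchor k) k

noncomputable def minAnchorWeight : ℝ :=
  c.anchorWeight G n S rep anchor (PolyComputable.minimizer (c.anchorWeight G n S rep anchor) none
    ((List.finRange K).map some))

noncomputable def score (τ : ℚ) : ℝ :=
  if c.residual G n S rep anchor ≤ τ then
    if c.anchored then c.minAnchorWeight G n S rep anchor else 0
  else -1

/-! ### Computability -/

section Computability

open PolyComputable

variable {ι : Type} (x : ι) (r : Fin N → ι) (a : Fin K → ι)

theorem _root_.RealRAM.PolyComputable.ite_exists_eq {α : Type*} (t : Finset α) (q : α → ι)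
    {h l : ℕ → (ℕ → ℕ → ℝ) → (ι → ℕ) → ℝ} (hh : PolyComputable h) (hl : PolyComputable l) :
    PolyComputable fun n S v => if ∃ j ∈ t, v x = v (q j) then h n S v else l n S v := by
  classical
  induction t using Finset.induction_on with
  | empty => simpa using hl
  | insert j t _ ih =>
    have := ite_index_le x (q j) (ite_index_le (q j) x hh ih) ih
    convert this using 4 with n S v
    simp only [Finset.exists_mem_insert]
    by_cases h1 : v x ≤ v (q j) <;> by_cases h2 : v (q j) ≤ v x <;>
      simp [h1, h2, le_antisymm_iff]

theorem rowMass_computable : PolyComputable fun n S v => rowMass n S (v x) :=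
  sum_range (f := fun _ S v => |S (v (some x)) (v none)|) (abs (entry _ _))

theorem colMass_computable : PolyComputable fun n S v => colMass n S (v x) :=
  sum_range (f := fun _ S v => |S (v none) (v (some x))|) (abs (entry _ _))

theorem compressed_computable (b : Fin N) :
    PolyComputable fun n S v => c.compressed n S (fun b => v (r b)) (v x) b :=
  div (mul (const _) (entry _ _)) (colMass_computable _)

theorem rowCost_computable (g : Fin K → ℚ) :
    PolyComputable fun n S v => c.rowCost n S (fun b => v (r b)) (v x) g :=
  finset_sum _ fun b => abs (sub (c.compressed_computable x r b)
    (finset_sum _ fun _ => mul (mul (rowMass_computable x) (const _)) (const _)))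

theorem rawLeft_computable (k : Fin K) : PolyComputable fun n S v =>
    c.rawLeft G n S (fun b => v (r b)) (fun k => v (a k)) (v x) k := by
  have hfit : PolyComputable fun n S v => rowMass n S (v x) *
      ((minimizer (c.rowCost n S (fun b => v (r b)) (v x)) 0 G k : ℚ) : ℝ) :=
    mul (rowMass_computable x) (apply_minimizer (φ := fun g _ _ _ => ((g k : ℚ) : ℝ))
      (c.rowCost_computable x r) (fun g => const (g k)) 0 G)
  simp only [rawLeft]
  cases c.anchored with
  | false => simpa using hfit
  | true =>
    simp only [true_and]
    have h := ite_exists_eq x {k} a (rowMass_computable x) hfit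
    simp only [mem_singleton, exists_eq_left] at h
    convert ite_exists_eq x (univ.erase k) a zero h

theorem topicMass_computable (k : Fin K) : PolyComputable fun n S v =>
    c.topicMass G n S (fun b => v (r b)) (fun k => v (a k)) k :=
  sum_range (c.rawLeft_computable G none (fun b => some (r b)) (fun k => some (a k)) k)

theorem left_computable (k : Fin K) : PolyComputable fun n S v =>
    c.left G n S (fun b => v (r b)) (fun k => v (a k)) (v x) k :=
  div (c.rawLeft_computable G x r a k) (c.topicMass_computable G r a k)

theorem colCost_computable (h : Fin K → ℚ) : PolyComputable fun n S v =>
    c.colCost G n S (fun b => v (r b)) (fun k => v (a k)) (v x) h :=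
  sum_range (f := fun n S v => |S (v none) (v (some x)) -
      ∑ k, c.left G n S (fun b => v (some (r b))) (fun k => v (some (a k))) (v none) k *
        (colMass n S (v (some x)) * h k)|)
    (abs (sub (entry _ _) (finset_sum _ fun k =>
      mul (c.left_computable G none (fun b => some (r b)) (fun k => some (a k)) k)
        (mul (colMass_computable (some x)) (const _)))))

theorem right_computable (k : Fin K) : PolyComputable fun n S v =>
    c.right G n S (fun b => v (r b)) (fun k => v (a k)) k (v x) :=
  mul (colMass_computable x) (apply_minimizer (φ := fun g _ _ _ => ((g k : ℚ) : ℝ))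
    (c.colCost_computable G x r a) (fun g => const (g k)) 0 G)

theorem residual_computable : PolyComputable fun n S v =>
    c.residual G n S (fun b => v (r b)) (fun k => v (a k)) := by
  refine sum_range (f := fun n S v => ∑ w ∈ range n, |S w (v none) - ∑ k,
    c.left G n S (fun b => v (some (r b))) (fun k => v (some (a k))) w k *
      c.right G n S (fun b => v (some (r b))) (fun k => v (some (a k))) k (v none)|) ?_
  refine sum_range (f := fun n S v => |S (v none) (v (some none)) - ∑ k,
    c.left G n S (fun b => v (some (some (r b)))) (fun k => v (some (some (a k)))) (v none) k *
      c.right G n S (fun b => v (some (some (r b)))) (fun k => v (some (some (a k)))) k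
        (v (some none))|) ?_
  exact abs (sub (entry _ _) (finset_sum _ fun k =>
    mul (c.left_computable G none (fun b => some (some (r b))) (fun k => some (some (a k))) k)
      (c.right_computable G (some none) (fun b => some (some (r b)))
        (fun k => some (some (a k))) k)))

theorem score_computable (τ : ℚ) : PolyComputable fun n S v =>
    c.score G n S (fun b => v (r b)) (fun k => v (a k)) τ := by
  have hw : ∀ o : Option (Fin K), PolyComputable fun n S v =>
      c.anchorWeight G n S (fun b => v (r b)) (fun k => v (a k)) o := by
    rintro (_ | k)
    · simpa [anchorWeight] using const (ι := ι) 1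
    · exact c.left_computable G (a k) r a k
  have hone : PolyComputable fun _ _ (_ : ι → ℕ) => (-1 : ℝ) := by simpa using const (ι := ι) (-1)
  refine ite_le (c.residual_computable G r a) (const τ) ?_ hone
  cases c.anchored with
  | false => simpa using zero
  | true =>
    simp only [if_true]
    exact apply_minimizer hw hw none _

end Computability

/-- The search for the best candidate. -/
noncomputable def searchProblem (K N : ℕ) (G : List (Fin K → ℚ)) (τ : ℚ) :
    SearchProblem (FitConstants K N) (N + K) K where
  score c n S v := c.score G n S (fun b => v (Fin.castAdd K b)) (fun k => v (Fin.natAdd N k)) τ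
  left c k n S v w :=
    c.left G n S (fun b => v (Fin.castAdd K b)) (fun k => v (Fin.natAdd N k)) w k
  right c k n S v z :=
    c.right G n S (fun b => v (Fin.castAdd K b)) (fun k => v (Fin.natAdd N k)) k z
  score_computable c := c.score_computable G _ _ τ
  left_computable c k := c.left_computable G none (fun b => some (Fin.castAdd K b))
    (fun k => some (Fin.natAdd N k)) k
  right_computable c k := c.right_computable G none (fun b => some (Fin.castAdd K b))
    (fun k => some (Fin.natAdd N k)) k

/-! ### Elementary properties -/

theorem rowMass_nonneg (w : ℕ) : 0 ≤ rowMass n S w := sum_nonneg fun _ _ => abs_nonneg _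

theorem colMass_nonneg (w : ℕ) : 0 ≤ colMass n S w := sum_nonneg fun _ _ => abs_nonneg _

variable {G} (hG : ∀ g ∈ G, ∀ i, 0 ≤ g i ∧ g i ≤ 1)
include hG

theorem minimizer_mem_Icc (F : (Fin K → ℚ) → ℝ) (k : Fin K) :
    (0 : ℝ) ≤ (PolyComputable.minimizer F 0 G k : ℚ) ∧
      ((PolyComputable.minimizer F 0 G k : ℚ) : ℝ) ≤ 1 := by
  rcases PolyComputable.minimizer_mem F 0 G with h | h
  · rw [h]; simp
  · exact_mod_cast hG _ h k

theorem rawLeft_nonneg (w : ℕ) (k : Fin K) : 0 ≤ c.rawLeft G n S rep anchor w k := by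
  have := minimizer_mem_Icc hG (c.rowCost n S rep w) k
  have := rowMass_nonneg n S w
  unfold rawLeft
  split_ifs
  · exact le_rfl
  · exact this
  · exact mul_nonneg this (minimizer_mem_Icc hG (c.rowCost n S rep w) k).1

theorem rawLeft_le (w : ℕ) (k : Fin K) : c.rawLeft G n S rep anchor w k ≤ rowMass n S w := by
  have := rowMass_nonneg n S w
  unfold rawLeft
  split_ifs
  · exact this
  · exact le_rfl
  · exact mul_le_of_le_one_right this (minimizer_mem_Icc hG (c.rowCost n S rep w) k).2

theorem topicMass_nonneg (k : Fin K) : 0 ≤ c.topicMass G n S rep anchor k :=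
  sum_nonneg fun _ _ => c.rawLeft_nonneg n S rep anchor hG _ _

theorem left_nonneg (w : ℕ) (k : Fin K) : 0 ≤ c.left G n S rep anchor w k :=
  div_nonneg (c.rawLeft_nonneg n S rep anchor hG _ _) (c.topicMass_nonneg n S rep anchor hG _)

theorem right_nonneg (k : Fin K) (z : ℕ) : 0 ≤ c.right G n S rep anchor k z :=
  mul_nonneg (colMass_nonneg n S z) (minimizer_mem_Icc hG _ k).1

theorem left_mul_topicMass {w : ℕ} (hw : w < n) (k : Fin K) :
    c.left G n S rep anchor w k * c.topicMass G n S rep anchor k =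
      c.rawLeft G n S rep anchor w k := by
  rcases eq_or_ne (c.topicMass G n S rep anchor k) 0 with h | h
  · rw [h, mul_zero]
    exact ((sum_eq_zero_iff_of_nonneg fun _ _ => c.rawLeft_nonneg n S rep anchor hG _ _).1 h w
      (mem_range.2 hw)).symm
  · exact div_mul_cancel₀ _ h

omit hG in
theorem sum_left (k : Fin K) : ∑ w ∈ range n, c.left G n S rep anchor w k =
    if c.topicMass G n S rep anchor k = 0 then 0 else 1 := by
  simp only [left, ← sum_div]
  change c.topicMass G n S rep anchor k / c.topicMass G n S rep anchor k = _
  split_ifs with h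
  · rw [h, div_zero]
  · exact div_self h

omit hG in
theorem sum_left_le (k : Fin K) : ∑ w ∈ range n, c.left G n S rep anchor w k ≤ 1 := by
  rw [sum_left]; split_ifs <;> norm_num

theorem left_le_one {w : ℕ} (hw : w < n) (k : Fin K) : c.left G n S rep anchor w k ≤ 1 :=
  (single_le_sum (f := fun w => c.left G n S rep anchor w k)
    (fun w _ => c.left_nonneg n S rep anchor hG w k) (mem_range.2 hw)).trans
    (c.sum_left_le n S rep anchor k)

omit hG in
theorem rawLeft_anchor (hc : c.anchored) (ha : Function.Injective anchor) (k : Fin K) :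
    c.rawLeft G n S rep anchor (anchor k) k = rowMass n S (anchor k) := by
  unfold rawLeft
  rw [if_neg, if_pos ⟨hc, rfl⟩]
  rintro ⟨-, l, hl, hl'⟩
  exact (mem_erase.1 hl).1 (ha hl'.symm)

omit hG in
theorem left_anchor_of_ne (hc : c.anchored) {j k : Fin K} (hjk : j ≠ k) :
    c.left G n S rep anchor (anchor j) k = 0 := by
  have : c.rawLeft G n S rep anchor (anchor j) k = 0 := by
    unfold rawLeft
    rw [if_pos ⟨hc, j, by simp [hjk], rfl⟩]
  rw [left, this, zero_div]

omit hG in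
theorem minAnchorWeight_le (k : Fin K) :
    c.minAnchorWeight G n S rep anchor ≤ c.left G n S rep anchor (anchor k) k :=
  PolyComputable.minimizer_le (c.anchorWeight G n S rep anchor) none _
    (b := some k) (by simp)

omit hG in
theorem le_minAnchorWeight {q : ℝ} (hq : q ≤ 1)
    (h : ∀ k, q ≤ c.left G n S rep anchor (anchor k) k) :
    q ≤ c.minAnchorWeight G n S rep anchor := by
  unfold minAnchorWeight
  cases PolyComputable.minimizer (c.anchorWeight G n S rep anchor) none
    ((List.finRange K).map some) with
  | none => exact hq
  | some k => exact h k

end FitConstants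

namespace FitConstants

open Finset RealRAM

variable {K N : ℕ}

theorem exists_scaled_grid_point {G : List (Fin K → ℚ)} {δ : ℝ}
    (hG : ∀ x : Fin K → ℝ, (∀ i, 0 ≤ x i ∧ x i ≤ 1) → ∃ g ∈ G, ∀ i, |x i - g i| ≤ δ)
    {a : Fin K → ℝ} (ha : ∀ k, 0 ≤ a k) :
    ∃ g ∈ G, ∀ k, |a k - (∑ l, a l) * g k| ≤ δ * ∑ l, a l := by
  have hr : 0 ≤ ∑ l, a l := sum_nonneg fun _ _ => ha _
  have hle : ∀ k, a k ≤ ∑ l, a l := fun k => single_le_sum (fun l _ => ha l) (mem_univ k)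
  obtain ⟨g, hg, h⟩ := hG (fun k => a k / ∑ l, a l) fun k =>
    ⟨div_nonneg (ha k) hr, div_le_one_of_le₀ (hle k) hr⟩
  refine ⟨g, hg, fun k => ?_⟩
  rcases hr.eq_or_lt with h0 | h0
  · have : a k = 0 := le_antisymm (h0 ▸ hle k) (ha k)
    simp [← h0, this]
  · have e : a k - (∑ l, a l) * g k = (a k / (∑ l, a l) - g k) * ∑ l, a l := by
      field_simp
    rw [e, abs_mul, abs_of_pos h0]
    exact mul_le_mul_of_nonneg_right (h k) h0.le

theorem sum_abs_sub_scaled_le {x : Fin N → ℝ} {a g : Fin K → ℝ} {V P : Fin K → Fin N → ℝ}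
    {r s δ : ℝ} (hr : 0 ≤ r) (hs : 0 ≤ s) (hδ : 0 ≤ δ) (hg : ∀ k, 0 ≤ g k ∧ g k ≤ 1)
    (ha : ∀ k, |a k - r * g k| ≤ δ * r) (hV : ∀ k b, 0 ≤ V k b) (hV1 : ∀ k, ∑ b, V k b ≤ 1)
    (hP : ∀ k b, |V k b - P k b| ≤ δ) :
    ∑ b, |x b - ∑ k, s * g k * P k b| ≤
      ∑ b, |x b - ∑ k, a k * V k b| + K * |r - s| + (K * r + K * N * s) * δ := by
  have h1 : ∀ k b, |a k * V k b - s * g k * P k b| ≤ (δ * r + |r - s|) * V k b + s * δ := by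
    intro k b
    have e : a k * V k b - s * g k * P k b =
        (a k - r * g k) * V k b + (r - s) * g k * V k b + s * (g k * (V k b - P k b)) := by ring
    rw [e]
    refine (abs_add_three _ _ _).trans ?_
    rw [add_mul]
    refine add_le_add (add_le_add ?_ ?_) ?_
    · rw [abs_mul, abs_of_nonneg (hV k b)]
      exact mul_le_mul_of_nonneg_right (ha k) (hV k b)
    · rw [abs_mul, abs_mul, abs_of_nonneg (hV k b), abs_of_nonneg (hg k).1]
      exact mul_le_mul_of_nonneg_right (mul_le_of_le_one_right (abs_nonneg _) (hg k).2) (hV k b)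
    · rw [abs_mul, abs_mul, abs_of_nonneg hs, abs_of_nonneg (hg k).1]
      refine mul_le_mul_of_nonneg_left ?_ hs
      exact (mul_le_of_le_one_left (abs_nonneg _) (hg k).2).trans (hP k b)
  calc ∑ b, |x b - ∑ k, s * g k * P k b|
      ≤ ∑ b, (|x b - ∑ k, a k * V k b| + ∑ k, ((δ * r + |r - s|) * V k b + s * δ)) := by
        refine sum_le_sum fun b _ => ?_
        have e : x b - ∑ k, s * g k * P k b =
            (x b - ∑ k, a k * V k b) + ∑ k, (a k * V k b - s * g k * P k b) := by
          rw [sum_sub_distrib]; ring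
        rw [e]
        exact (abs_add_le _ _).trans (add_le_add le_rfl
          ((abs_sum_le_sum_abs _ _).trans (sum_le_sum fun k _ => h1 k b)))
    _ = ∑ b, |x b - ∑ k, a k * V k b| +
        ∑ k, ((δ * r + |r - s|) * ∑ b, V k b + N * (s * δ)) := by
        rw [sum_add_distrib, sum_comm]
        congr 1
        refine sum_congr rfl fun k _ => ?_
        rw [sum_add_distrib, ← mul_sum]
        simp
    _ ≤ ∑ b, |x b - ∑ k, a k * V k b| + ∑ _k : Fin K, ((δ * r + |r - s|) * 1 + N * (s * δ)) := by
        have : 0 ≤ δ * r + |r - s| := by positivity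
        gcongr with k
        exact hV1 k
    _ = _ := by
        simp only [sum_const, card_univ, Fintype.card_fin, nsmul_eq_mul]
        ring

variable (c : FitConstants K N) {G : List (Fin K → ℚ)} (n : ℕ) (S : ℕ → ℕ → ℝ)
  (rep : Fin N → ℕ) (anchor : Fin K → ℕ)

/-- The cost of the fitted row is at most that of any row near a grid point. -/
theorem sum_abs_compressed_sub_rawLeft_le {δ : ℝ} (hδ : 0 ≤ δ)
    (hG : ∀ g ∈ G, ∀ i, 0 ≤ g i ∧ g i ≤ 1)
    (hGd : ∀ x : Fin K → ℝ, (∀ i, 0 ≤ x i ∧ x i ≤ 1) → ∃ g ∈ G, ∀ i, |x i - g i| ≤ δ)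
    {a : Fin K → ℝ} (ha : ∀ k, 0 ≤ a k) {V : Fin K → Fin N → ℝ} (hV : ∀ k b, 0 ≤ V k b)
    (hV1 : ∀ k, ∑ b, V k b ≤ 1) (hP : ∀ k b, |V k b - c.profile k b| ≤ δ)
    (hanc : c.anchored → Function.Injective anchor) (w : ℕ)
    (hw : c.anchored → ∀ j, w = anchor j → ∀ k, k ≠ j → a k = 0) :
    ∑ b, |c.compressed n S rep w b - ∑ k, c.rawLeft G n S rep anchor w k * c.profile k b| ≤
      ∑ b, |c.compressed n S rep w b - ∑ k, a k * V k b| + K * |∑ k, a k - rowMass n S w| +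
        (K * (∑ k, a k) + K * N * rowMass n S w) * δ := by
  have hr : 0 ≤ ∑ k, a k := sum_nonneg fun _ _ => ha _
  by_cases h : c.anchored ∧ ∃ j, w = anchor j
  · obtain ⟨hc, j, hj⟩ := h
    have hraw : ∀ k, c.rawLeft G n S rep anchor w k =
        rowMass n S w * (if k = j then 1 else 0 : ℝ) := by
      intro k
      unfold rawLeft
      by_cases hk : k = j
      · subst hk
        rw [if_neg, if_pos ⟨hc, hj⟩, if_pos rfl, mul_one]
        rintro ⟨-, l, hl, hl'⟩
        exact (mem_erase.1 hl).1 (hanc hc (hl'.symm.trans hj))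
      · rw [if_pos ⟨hc, j, by simp [Ne.symm hk], hj⟩, if_neg hk, mul_zero]
    simp only [hraw]
    refine sum_abs_sub_scaled_le hr (rowMass_nonneg n S w) hδ ?_ ?_ hV hV1 hP
    · intro k; split_ifs <;> simp
    · intro k
      have hz := hw hc j hj
      have hs : ∑ k, a k = a j := sum_eq_single j (fun k _ hk => hz k hk) (by simp)
      by_cases hk : k = j
      · subst hk
        simp [hs, mul_nonneg hδ (ha _)]
      · simp [hk, hz k hk, mul_nonneg hδ hr]
  · have hraw : ∀ k, c.rawLeft G n S rep anchor w k =
        rowMass n S w * PolyComputable.minimizer (c.rowCost n S rep w) 0 G k := by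
      intro k
      unfold rawLeft
      rw [if_neg, if_neg]
      · rintro ⟨hc, hk⟩; exact h ⟨hc, k, hk⟩
      · rintro ⟨hc, j, -, hj⟩; exact h ⟨hc, j, hj⟩
    simp only [hraw]
    obtain ⟨g, hg, hga⟩ := exists_scaled_grid_point hGd ha
    refine (PolyComputable.minimizer_le (c.rowCost n S rep w) 0 G hg).trans ?_
    exact sum_abs_sub_scaled_le hr (rowMass_nonneg n S w) hδ
      (fun k => by exact_mod_cast hG g hg k) hga hV hV1 hP

/-- The cost of the fitted column. -/
theorem sum_abs_sub_left_mul_right_le {δ : ℝ} (hδ : 0 ≤ δ)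
    (hG : ∀ g ∈ G, ∀ i, 0 ≤ g i ∧ g i ≤ 1)
    (hGd : ∀ x : Fin K → ℝ, (∀ i, 0 ≤ x i ∧ x i ≤ 1) → ∃ g ∈ G, ∀ i, |x i - g i| ≤ δ)
    {V : Fin K → ℝ} (hV : ∀ k, 0 ≤ V k) (z : ℕ) :
    ∑ w ∈ range n, |S w z - ∑ k, c.left G n S rep anchor w k * c.right G n S rep anchor k z| ≤
      (1 + K) * (∑ w ∈ range n, |S w z - ∑ k, c.rawLeft G n S rep anchor w k * V k|) +
        K * δ * ∑ k, c.topicMass G n S rep anchor k * V k := by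
  set H : Fin K → ℝ := fun k => c.topicMass G n S rep anchor k * V k with hH
  have hH0 : ∀ k, 0 ≤ H k := fun k => mul_nonneg (c.topicMass_nonneg n S rep anchor hG k) (hV k)
  set y := ∑ w ∈ range n, |S w z - ∑ k, c.rawLeft G n S rep anchor w k * V k| with hy
  have hraw0 := c.rawLeft_nonneg n S rep anchor hG
  have hη : |∑ k, H k - colMass n S z| ≤ y := by
    have e : ∑ k, H k = ∑ w ∈ range n, |∑ k, c.rawLeft G n S rep anchor w k * V k| := by
      rw [sum_congr rfl fun w _ => abs_of_nonneg (sum_nonneg fun k _ =>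
        mul_nonneg (hraw0 w k) (hV k)), sum_comm]
      refine sum_congr rfl fun k _ => ?_
      rw [← sum_mul]; rfl
    rw [e, colMass, ← sum_sub_distrib]
    refine (abs_sum_le_sum_abs _ _).trans (sum_le_sum fun w _ => ?_)
    rw [abs_sub_comm (S w z)]
    exact abs_abs_sub_abs_le _ _
  obtain ⟨g, hg, hgH⟩ := exists_scaled_grid_point hGd hH0
  refine (PolyComputable.minimizer_le (c.colCost G n S rep anchor z) 0 G hg).trans ?_
  have hg01 : ∀ k, (0 : ℝ) ≤ g k ∧ (g k : ℝ) ≤ 1 := fun k => by exact_mod_cast hG g hg k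
  have hd : ∀ k, |H k - colMass n S z * g k| ≤ δ * (∑ k, H k) + y := by
    intro k
    have e : H k - colMass n S z * g k =
        (H k - (∑ k, H k) * g k) + (∑ k, H k - colMass n S z) * g k := by ring
    rw [e]
    refine (abs_add_le _ _).trans (add_le_add (hgH k) ?_)
    rw [abs_mul, abs_of_nonneg (hg01 k).1]
    exact (mul_le_of_le_one_right (abs_nonneg _) (hg01 k).2).trans hη
  have hB : 0 ≤ δ * (∑ k, H k) + y :=
    add_nonneg (mul_nonneg hδ (sum_nonneg fun k _ => hH0 k)) (sum_nonneg fun _ _ => abs_nonneg _)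
  calc c.colCost G n S rep anchor z g
      ≤ ∑ w ∈ range n, (|S w z - ∑ k, c.rawLeft G n S rep anchor w k * V k| +
          ∑ k, c.left G n S rep anchor w k * (δ * (∑ k, H k) + y)) := by
        refine sum_le_sum fun w hw => ?_
        have e : S w z - ∑ k, c.left G n S rep anchor w k * (colMass n S z * g k) =
            (S w z - ∑ k, c.rawLeft G n S rep anchor w k * V k) +
              ∑ k, c.left G n S rep anchor w k * (H k - colMass n S z * g k) := by
          simp only [mul_sub, sum_sub_distrib, hH, ← mul_assoc]
          simp only [c.left_mul_topicMass n S rep anchor hG (mem_range.1 hw)]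
          ring
        rw [e]
        refine (abs_add_le _ _).trans (add_le_add le_rfl ((abs_sum_le_sum_abs _ _).trans ?_))
        refine sum_le_sum fun k _ => ?_
        have h0 := c.left_nonneg n S rep anchor hG w k
        rw [abs_mul, abs_of_nonneg h0]
        exact mul_le_mul_of_nonneg_left (hd k) h0
    _ = y + ∑ k, (∑ w ∈ range n, c.left G n S rep anchor w k) * (δ * (∑ k, H k) + y) := by
        rw [sum_add_distrib, sum_comm]
        simp only [sum_mul]
        rfl
    _ ≤ y + ∑ _k : Fin K, 1 * (δ * (∑ k, H k) + y) := by
        gcongr with k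
        exact c.sum_left_le n S rep anchor k
    _ = _ := by
        simp only [sum_const, card_univ, Fintype.card_fin, nsmul_eq_mul]
        ring

theorem abs_sum_sub_rowMass_le {A : ℕ → Fin K → ℝ} (hA : ∀ w k, 0 ≤ A w k)
    {V : Fin K → ℕ → ℝ} (hV : ∀ k z, 0 ≤ V k z)
    (hAV : ∀ w k, A w k * ∑ z ∈ range n, V k z = A w k) (w : ℕ) :
    |∑ k, A w k - rowMass n S w| ≤ ∑ z ∈ range n, |S w z - ∑ k, A w k * V k z| := by
  have e1 : ∑ k, A w k = ∑ z ∈ range n, |∑ k, A w k * V k z| := by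
    rw [sum_congr rfl fun z _ => abs_of_nonneg (sum_nonneg fun k _ =>
      mul_nonneg (hA w k) (hV k z)), sum_comm]
    refine sum_congr rfl fun k _ => ?_
    rw [← mul_sum, hAV]
  rw [e1, rowMass, ← sum_sub_distrib]
  refine (abs_sum_le_sum_abs _ _).trans (sum_le_sum fun z _ => ?_)
  rw [abs_sub_comm (S w z)]
  exact abs_abs_sub_abs_le _ _

theorem sum_rowMass_le {A : ℕ → Fin K → ℝ} (hA : ∀ w k, 0 ≤ A w k)
    {V : Fin K → ℕ → ℝ} (hV : ∀ k z, 0 ≤ V k z) {m e : ℝ}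
    (hAm : ∑ w ∈ range n, ∑ k, A w k ≤ m)
    (hAV : ∀ w k, A w k * ∑ z ∈ range n, V k z = A w k)
    (hE : ∑ w ∈ range n, ∑ z ∈ range n, |S w z - ∑ k, A w k * V k z| ≤ e) :
    ∑ w ∈ range n, rowMass n S w ≤ m + e := by
  have : ∑ w ∈ range n, rowMass n S w ≤ ∑ w ∈ range n, (∑ k, A w k +
      ∑ z ∈ range n, |S w z - ∑ k, A w k * V k z|) := by
    refine sum_le_sum fun w _ => ?_
    have := (abs_le.1 (abs_sum_sub_rowMass_le n S hA hV hAV w)).1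
    linarith
  rw [sum_add_distrib] at this
  linarith

/-- The residual of a candidate whose constants and indices approximate a nonnegative
factorisation `A * V` of a matrix near `S`. -/
theorem residual_le {δ₁ δ₂ e D m : ℝ} (hδ₁ : 0 ≤ δ₁) (hδ : 0 ≤ δ₂)
    (hG : ∀ g ∈ G, ∀ i, 0 ≤ g i ∧ g i ≤ 1)
    (hGd : ∀ x : Fin K → ℝ, (∀ i, 0 ≤ x i ∧ x i ≤ 1) → ∃ g ∈ G, ∀ i, |x i - g i| ≤ δ₂)
    {A : ℕ → Fin K → ℝ} (hA : ∀ w k, 0 ≤ A w k) {V : Fin K → ℕ → ℝ} (hV : ∀ k z, 0 ≤ V k z)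
    (hAm : ∑ w ∈ range n, ∑ k, A w k ≤ m) (hV1 : ∀ k, ∑ z ∈ range n, V k z ≤ 1)
    (hAV : ∀ w k, A w k * ∑ z ∈ range n, V k z = A w k)
    (hE : ∑ w ∈ range n, ∑ z ∈ range n, |S w z - ∑ k, A w k * V k z| ≤ e)
    {cl : ℕ → Fin N} (hcl : ∀ z z', cl z = cl z' → ∀ k,
      |V k z * ∑ l, V l z' - V k z' * ∑ l, V l z| ≤ δ₁ * (∑ l, V l z) * ∑ l, V l z')
    (hP : ∀ k b, |classSum n V cl k b - c.profile k b| ≤ δ₂)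
    (hD : ∑ w ∈ range n, ∑ b,
      |c.compressed n S rep w b - ∑ k, A w k * classSum n V cl k b| ≤ D)
    (hanc : c.anchored → Function.Injective anchor)
    (hanc' : c.anchored → ∀ j k, k ≠ j → A (anchor j) k = 0) :
    c.residual G n S rep anchor ≤ (1 + K) * (2 * D + (1 + K) * e +
      (K * m + 2 * (K * N * (m + e))) * δ₂ + δ₁ * K * (K * (m + e) + m)) +
      K * δ₂ * (K * (m + e)) := by
  set s := rowMass n S with hs
  set U := c.rawLeft G n S rep anchor with hU
  have hs0 : ∀ w, 0 ≤ s w := rowMass_nonneg n S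
  have hU0 : ∀ w k, 0 ≤ U w k := c.rawLeft_nonneg n S rep anchor hG
  have hUs : ∀ w k, U w k ≤ s w := c.rawLeft_le n S rep anchor hG
  have hcs0 : ∀ k b, 0 ≤ classSum n V cl k b := classSum_nonneg hV
  have hcs1 : ∀ k, ∑ b, classSum n V cl k b ≤ 1 := fun k => (sum_classSum k).trans_le (hV1 k)
  have hrs' : ∑ w ∈ range n, |∑ k, A w k - s w| ≤ e :=
    (sum_le_sum fun w _ => abs_sum_sub_rowMass_le n S hA hV hAV w).trans hE
  have hsm : ∑ w ∈ range n, s w ≤ m + e := sum_rowMass_le n S hA hV hAm hAV hE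
  have hs00 : 0 ≤ ∑ w ∈ range n, s w := sum_nonneg fun w _ => hs0 w
  -- the fit on the compressed matrix
  have h1 : ∑ w ∈ range n, ∑ b, |∑ k, (U w k - A w k) * classSum n V cl k b| ≤
      2 * D + K * e + (K * m + 2 * (K * N * (m + e))) * δ₂ := by
    calc ∑ w ∈ range n, ∑ b, |∑ k, (U w k - A w k) * classSum n V cl k b|
        ≤ ∑ w ∈ range n, (2 * (∑ b,
            |c.compressed n S rep w b - ∑ k, A w k * classSum n V cl k b|) +
            K * |∑ k, A w k - s w| + (K * (∑ k, A w k) + 2 * (K * N * s w)) * δ₂) := by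
          refine sum_le_sum fun w _ => ?_
          have hrow := c.sum_abs_compressed_sub_rawLeft_le n S rep anchor hδ hG hGd (hA w) hcs0
            hcs1 hP hanc w (fun hc j hj k hk => by rw [hj]; exact hanc' hc j k hk)
          have hstep : ∑ b, |∑ k, (U w k - A w k) * classSum n V cl k b| ≤
              ∑ b, (|c.compressed n S rep w b - ∑ k, A w k * classSum n V cl k b| +
                |c.compressed n S rep w b - ∑ k, U w k * c.profile k b| +
                  ∑ _k : Fin K, s w * δ₂) := by
            refine sum_le_sum fun b _ => ?_
            have e1 : ∑ k, (U w k - A w k) * classSum n V cl k b =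
                (c.compressed n S rep w b - ∑ k, A w k * classSum n V cl k b) +
                -(c.compressed n S rep w b - ∑ k, U w k * c.profile k b) +
                ∑ k, U w k * (classSum n V cl k b - c.profile k b) := by
              simp only [sub_mul, mul_sub, sum_sub_distrib]; ring
            rw [e1]
            refine (abs_add_three _ _ _).trans ?_
            rw [abs_neg]
            refine add_le_add le_rfl ((abs_sum_le_sum_abs _ _).trans (sum_le_sum fun k _ => ?_))
            rw [abs_mul, abs_of_nonneg (hU0 w k)]
            exact mul_le_mul (hUs w k) (hP k b) (abs_nonneg _) (hs0 w)
          rw [sum_add_distrib, sum_add_distrib] at hstep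
          simp only [sum_const, card_univ, Fintype.card_fin, nsmul_eq_mul] at hstep
          have hrow' : ∑ b, |c.compressed n S rep w b - ∑ k, U w k * c.profile k b| ≤
            ∑ b, |c.compressed n S rep w b - ∑ k, A w k * classSum n V cl k b| +
              K * |∑ k, A w k - s w| + (K * (∑ k, A w k) + K * N * s w) * δ₂ := hrow
          linarith
      _ = 2 * (∑ w ∈ range n, ∑ b,
            |c.compressed n S rep w b - ∑ k, A w k * classSum n V cl k b|) +
            K * (∑ w ∈ range n, |∑ k, A w k - s w|) +
            (K * (∑ w ∈ range n, ∑ k, A w k) + 2 * (K * N * ∑ w ∈ range n, s w)) * δ₂ := by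
          simp only [sum_add_distrib, ← mul_sum, ← sum_mul]
      _ ≤ _ := by gcongr
  -- the fit on the whole matrix
  have h2 : ∑ w ∈ range n, ∑ z ∈ range n, |∑ k, (U w k - A w k) * V k z| ≤
      2 * D + K * e + (K * m + 2 * (K * N * (m + e))) * δ₂ + δ₁ * K * (K * (m + e) + m) := by
    have hVK : ∑ z ∈ range n, ∑ k, V k z ≤ K := by
      rw [sum_comm]
      calc ∑ k, ∑ z ∈ range n, V k z ≤ ∑ _k : Fin K, (1 : ℝ) := sum_le_sum fun k _ => hV1 k
        _ = K := by simp
    have hVK0 : 0 ≤ ∑ z ∈ range n, ∑ k, V k z := sum_nonneg fun z _ => sum_nonneg fun k _ => hV k z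
    have hd : ∑ w ∈ range n, ∑ k, |U w k - A w k| ≤ K * (m + e) + m := by
      calc ∑ w ∈ range n, ∑ k, |U w k - A w k|
          ≤ ∑ w ∈ range n, ∑ k, (s w + A w k) := by
            refine sum_le_sum fun w _ => sum_le_sum fun k _ => ?_
            rw [abs_le]
            constructor <;> linarith [hUs w k, hU0 w k, hA w k]
        _ = K * (∑ w ∈ range n, s w) + ∑ w ∈ range n, ∑ k, A w k := by
            simp [sum_add_distrib, mul_sum]
        _ ≤ _ := by gcongr
    calc ∑ w ∈ range n, ∑ z ∈ range n, |∑ k, (U w k - A w k) * V k z|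
        ≤ ∑ w ∈ range n, (∑ b, |∑ k, (U w k - A w k) * classSum n V cl k b| +
            δ₁ * (∑ k, |U w k - A w k|) * ∑ z ∈ range n, ∑ k, V k z) :=
          sum_le_sum fun w _ => sum_abs_le_sum_abs_classSum hV hcl _
      _ = ∑ w ∈ range n, ∑ b, |∑ k, (U w k - A w k) * classSum n V cl k b| +
            δ₁ * (∑ w ∈ range n, ∑ k, |U w k - A w k|) * ∑ z ∈ range n, ∑ k, V k z := by
          rw [sum_add_distrib, ← sum_mul, ← mul_sum]
      _ ≤ (2 * D + K * e + (K * m + 2 * (K * N * (m + e))) * δ₂) +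
            δ₁ * (K * (m + e) + m) * K := by
          have : 0 ≤ ∑ w ∈ range n, ∑ k, |U w k - A w k| :=
            sum_nonneg fun _ _ => sum_nonneg fun _ _ => abs_nonneg _
          gcongr
          exact mul_nonneg hδ₁ (this.trans hd)
      _ = _ := by ring
  have h3 : ∑ z ∈ range n, ∑ w ∈ range n, |S w z - ∑ k, U w k * V k z| ≤
      2 * D + (1 + K) * e + (K * m + 2 * (K * N * (m + e))) * δ₂ +
        δ₁ * K * (K * (m + e) + m) := by
    rw [sum_comm]
    calc ∑ w ∈ range n, ∑ z ∈ range n, |S w z - ∑ k, U w k * V k z|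
        ≤ ∑ w ∈ range n, ∑ z ∈ range n, (|S w z - ∑ k, A w k * V k z| +
            |∑ k, (U w k - A w k) * V k z|) := by
          refine sum_le_sum fun w _ => sum_le_sum fun z _ => ?_
          have e1 : S w z - ∑ k, U w k * V k z = (S w z - ∑ k, A w k * V k z) -
              ∑ k, (U w k - A w k) * V k z := by
            simp only [sub_mul, sum_sub_distrib]; ring
          rw [e1]
          exact abs_sub _ _
      _ ≤ _ := by
          simp only [sum_add_distrib]
          linarith
  -- the right factor
  have h4 : ∑ z ∈ range n, ∑ k, c.topicMass G n S rep anchor k * V k z ≤ K * (m + e) := by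
    rw [sum_comm]
    calc ∑ k, ∑ z ∈ range n, c.topicMass G n S rep anchor k * V k z
        ≤ ∑ _k : Fin K, (m + e) := by
          refine sum_le_sum fun k _ => ?_
          rw [← mul_sum]
          refine (mul_le_of_le_one_right (c.topicMass_nonneg n S rep anchor hG k) (hV1 k)).trans ?_
          exact (sum_le_sum fun w _ => hUs w k).trans hsm
      _ = _ := by simp [mul_add]
  calc c.residual G n S rep anchor
      ≤ ∑ z ∈ range n, ((1 + K) * (∑ w ∈ range n, |S w z - ∑ k, U w k * V k z|) +
        K * δ₂ * ∑ k, c.topicMass G n S rep anchor k * V k z) :=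
        sum_le_sum fun z _ => c.sum_abs_sub_left_mul_right_le n S rep anchor hδ hG hGd
          (fun k => hV k z) z
    _ = (1 + K) * (∑ z ∈ range n, ∑ w ∈ range n, |S w z - ∑ k, U w k * V k z|) +
        K * δ₂ * ∑ z ∈ range n, ∑ k, c.topicMass G n S rep anchor k * V k z := by
        rw [sum_add_distrib, ← mul_sum, ← mul_sum]
    _ ≤ _ := by gcongr

end FitConstants

namespace FitConstants

open Finset RealRAM

/-- A finite list of constants such that, for every matrix `S` near a nonnegative factorisation
`A * V`, some candidate with these constants has a small residual. -/
theorem exists_constants (K m : ℕ) {e : ℝ} (he : 0 < e) :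
    ∃ (N : ℕ) (G : List (Fin K → ℚ)) (cs : List (FitConstants K N)),
      (∀ g ∈ G, ∀ i, 0 ≤ g i ∧ g i ≤ 1) ∧
      ∀ (n : ℕ) (S : ℕ → ℕ → ℝ) (A : ℕ → Fin K → ℝ) (V : Fin K → ℕ → ℝ), 0 < n →
        (∀ w k, 0 ≤ A w k) → (∀ k z, 0 ≤ V k z) → ∑ w ∈ range n, ∑ k, A w k ≤ m →
        (∀ k, ∑ z ∈ range n, V k z ≤ 1) → (∀ w k, A w k * ∑ z ∈ range n, V k z = A w k) →
        ∑ w ∈ range n, ∑ z ∈ range n, |S w z - ∑ k, A w k * V k z| ≤ e →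
        ∀ (anchored : Bool) (anchor : Fin K → ℕ),
          (anchored → Function.Injective anchor ∧ ∀ j k, k ≠ j → A (anchor j) k = 0) →
          ∃ c ∈ cs, c.anchored = anchored ∧ ∃ rep : Fin N → ℕ, (∀ b, rep b < n) ∧
            c.residual G n S rep anchor ≤ ((1 + K) * (5 + K) + 1) * e := by
  set X₁ : ℝ := (1 + K) * (4 * m * K + K * (K * (m + e) + m)) with hX₁
  have hX₁0 : 0 ≤ X₁ := by positivity
  set δ₁ : ℝ := e / (2 * (X₁ + 1)) with hδ₁
  have hδ₁0 : 0 < δ₁ := by positivity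
  have hδX₁ : δ₁ * X₁ ≤ e / 2 := by
    rw [hδ₁, div_mul_eq_mul_div, div_le_div_iff₀ (by positivity) (by positivity)]
    nlinarith
  obtain ⟨N, cls, hcls⟩ := exists_classes K hδ₁0
  set X₂ : ℝ := (1 + K) * (2 * N + K * m + 2 * (K * N * (m + e))) + K * (K * (m + e)) with hX₂
  have hX₂0 : 0 ≤ X₂ := by positivity
  set δ₂ : ℝ := e / (2 * (X₂ + 1)) with hδ₂
  have hδ₂0 : 0 < δ₂ := by positivity
  have hδX₂ : δ₂ * X₂ ≤ e / 2 := by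
    rw [hδ₂, div_mul_eq_mul_div, div_le_div_iff₀ (by positivity) (by positivity)]
    nlinarith
  obtain ⟨G, hG, hGd⟩ := exists_grid (Fin K) 1 hδ₂0
  obtain ⟨Gμ, -, hGμ⟩ := exists_grid (Fin N) m hδ₂0
  obtain ⟨GP, -, hGP⟩ := exists_grid (Fin K × Fin N) 1 hδ₂0
  simp only [Nat.cast_one] at hG hGd hGP
  refine ⟨N, G, Gμ.flatMap fun μ => GP.flatMap fun P =>
    [⟨μ, fun k b => P (k, b), true⟩, ⟨μ, fun k b => P (k, b), false⟩], hG, ?_⟩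
  intro n S A V hn hA hV hAm hV1 hAV hE anchored anchor hanc
  set cl : ℕ → Fin N := fun z => cls fun k => V k z / ∑ l, V l z with hcl_def
  have hv0 : ∀ z, 0 ≤ ∑ l, V l z := fun z => sum_nonneg fun l _ => hV l z
  have hVle : ∀ z k, V k z ≤ ∑ l, V l z := fun z k =>
    single_le_sum (fun l _ => hV l z) (mem_univ k)
  have hcl : ∀ z z', cl z = cl z' → ∀ k,
      |V k z * ∑ l, V l z' - V k z' * ∑ l, V l z| ≤ δ₁ * (∑ l, V l z) * ∑ l, V l z' := by
    intro z z' h k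
    have h01 : ∀ z k, 0 ≤ V k z / ∑ l, V l z ∧ V k z / ∑ l, V l z ≤ 1 := fun z k =>
      ⟨div_nonneg (hV k z) (hv0 z), div_le_one_of_le₀ (hVle z k) (hv0 z)⟩
    have hk := hcls _ _ (h01 z) (h01 z') h k
    rcases (hv0 z).eq_or_lt with h0 | h0
    · have : V k z = 0 := le_antisymm (h0 ▸ hVle z k) (hV k z)
      simp [← h0, this]
    rcases (hv0 z').eq_or_lt with h0' | h0'
    · have : V k z' = 0 := le_antisymm (h0' ▸ hVle z' k) (hV k z')
      simp [← h0', this]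
    have e1 : V k z * ∑ l, V l z' - V k z' * ∑ l, V l z =
        (V k z / (∑ l, V l z) - V k z' / ∑ l, V l z') * ((∑ l, V l z) * ∑ l, V l z') := by
      field_simp
    rw [e1, abs_mul, abs_of_pos (mul_pos h0 h0'), mul_assoc]
    exact mul_le_mul_of_nonneg_right hk (mul_pos h0 h0').le
  choose rep hrep t ht hrt using fun b => exists_representative (cl := cl) hn hV hcl hA S b
  have hcs0 : ∀ k b, 0 ≤ classSum n V cl k b := classSum_nonneg hV
  have hcs1 : ∀ k b, classSum n V cl k b ≤ 1 := fun k b =>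
    (single_le_sum (fun b _ => hcs0 k b) (mem_univ b)).trans ((sum_classSum k).trans_le (hV1 k))
  have hM0 : ∀ w b, 0 ≤ ∑ k, A w k * classSum n V cl k b := fun w b =>
    sum_nonneg fun k _ => mul_nonneg (hA w k) (hcs0 k b)
  obtain ⟨P, hPG, hP⟩ := hGP (fun p => classSum n V cl p.1 p.2) fun p => ⟨hcs0 _ _, hcs1 _ _⟩
  obtain ⟨μ, hμG, hμ⟩ := hGμ (fun b => ∑ w ∈ range n, |∑ k, A w k * classSum n V cl k b|)
    fun b => ⟨sum_nonneg fun _ _ => abs_nonneg _, by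
      refine le_trans (sum_le_sum fun w _ => ?_) hAm
      rw [abs_of_nonneg (hM0 w b)]
      exact sum_le_sum fun k _ => mul_le_of_le_one_right (hA w k) (hcs1 k b)⟩
  refine ⟨⟨μ, fun k b => P (k, b), anchored⟩, ?_, rfl, rep, hrep, ?_⟩
  · refine List.mem_flatMap.2 ⟨μ, hμG, List.mem_flatMap.2 ⟨P, hPG, ?_⟩⟩
    cases anchored <;> simp
  have hVK : ∑ b, classMass n V cl b ≤ K := by
    rw [sum_classMass, sum_comm]
    calc ∑ k, ∑ z ∈ range n, V k z ≤ ∑ _k : Fin K, (1 : ℝ) := sum_le_sum fun k _ => hV1 k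
      _ = K := by simp
  have hD : ∑ w ∈ range n, ∑ b, |compressed ⟨μ, fun k b => P (k, b), anchored⟩ n S rep w b -
      ∑ k, A w k * classSum n V cl k b| ≤ 2 * (e + m * δ₁ * K) + N * δ₂ := by
    rw [sum_comm]
    calc _ ≤ ∑ b, (2 * ((∑ z ∈ range n with cl z = b, ∑ w ∈ range n,
          |S w z - ∑ k, A w k * V k z|) + m * δ₁ * classMass n V cl b) + δ₂) := by
          refine sum_le_sum fun b _ => ?_
          refine (sum_abs_normalize_sub_le (range n) (fun w => S w (rep b)) _ (μ b) (ht b)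
            (hrt b)).trans ?_
          have h1 := hμ b
          have h2 : (∑ w ∈ range n, ∑ k, A w k) * δ₁ * classMass n V cl b ≤
              m * δ₁ * classMass n V cl b := by
            have := classMass_nonneg (n := n) (cl := cl) hV b
            gcongr
          linarith
      _ = 2 * ((∑ w ∈ range n, ∑ z ∈ range n, |S w z - ∑ k, A w k * V k z|) +
            m * δ₁ * ∑ b, classMass n V cl b) + N * δ₂ := by
          rw [sum_add_distrib, ← mul_sum, sum_add_distrib, ← mul_sum, sum_fiberwise,
            sum_comm (s := range n)]
          simp
      _ ≤ _ := by gcongr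
  refine (residual_le (δ₁ := δ₁) (δ₂ := δ₂) (e := e) (m := m) (cl := cl) _ n S rep anchor hδ₁0.le
    hδ₂0.le hG hGd hA hV hAm hV1 hAV hE hcl (fun k b => hP (k, b)) hD (fun h => (hanc h).1)
    (fun h => (hanc h).2)).trans ?_
  have e1 : (1 + K) * (2 * (2 * (e + m * δ₁ * K) + N * δ₂) + (1 + K) * e +
      (K * m + 2 * (K * N * (m + e))) * δ₂ + δ₁ * K * (K * (m + e) + m)) +
      K * δ₂ * (K * (m + e)) = (1 + K) * (5 + K) * e + δ₁ * X₁ + δ₂ * X₂ := by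
    rw [hX₁, hX₂]; ring
  rw [e1]
  linarith

end FitConstants

/-! ### Stability of separable factorisations -/

section Stability

open Finset

variable {ι : Type*} [Fintype ι] {K : ℕ}

/-- The rows of the right factor are recovered from anchor rows of the left factor. -/
theorem sum_abs_sub_anchor_combination_le {U T : ι → Fin K → ℝ} {V W : Fin K → ι → ℝ} {p e : ℝ}
    (hp : 0 < p) {a : Fin K → ι} (ha : ∀ k, p ≤ U (a k) k)
    (ha0 : ∀ k l, l ≠ k → U (a k) l = 0)
    (he : ∑ w, ∑ z, |∑ k, T w k * W k z - ∑ k, U w k * V k z| ≤ e) (k : Fin K) :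
    ∑ z, |V k z - ∑ l, T (a k) l / U (a k) k * W l z| ≤ e / p := by
  have hpos : 0 < U (a k) k := hp.trans_le (ha k)
  have h1 : ∑ z, |∑ l, T (a k) l * W l z - ∑ l, U (a k) l * V l z| ≤ e :=
    (single_le_sum (f := fun w => ∑ z, |∑ k, T w k * W k z - ∑ k, U w k * V k z|)
      (fun _ _ => sum_nonneg fun _ _ => abs_nonneg _) (mem_univ (a k))).trans he
  have he0 : 0 ≤ e := (sum_nonneg fun _ _ => abs_nonneg _).trans h1
  calc ∑ z, |V k z - ∑ l, T (a k) l / U (a k) k * W l z|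
      = (∑ z, |∑ l, T (a k) l * W l z - ∑ l, U (a k) l * V l z|) / U (a k) k := by
        rw [sum_div]
        refine sum_congr rfl fun z _ => ?_
        have e1 : ∑ l, U (a k) l * V l z = U (a k) k * V k z :=
          sum_eq_single k (fun l _ hl => by rw [ha0 k l hl, zero_mul]) (by simp)
        have e2 : ∑ l, T (a k) l / U (a k) k * W l z =
            (∑ l, T (a k) l * W l z) / U (a k) k := by
          rw [sum_div]; exact sum_congr rfl fun l _ => by ring
        rw [← abs_of_pos hpos, ← abs_div, abs_of_pos hpos, e1, e2, abs_sub_comm]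
        congr 1
        field_simp
    _ ≤ e / U (a k) k := by gcongr
    _ ≤ e / p := by gcongr; exact ha k

/-- Two separable nonnegative factorisations with nearby products have nearby left factors, up to
a permutation of the topics. -/
theorem exists_perm_sum_abs_sub_le {U T : ι → Fin K → ℝ} {V W : Fin K → ι → ℝ} {p q e : ℝ}
    (hp : 0 < p) (hq : 0 < q) (hU : ∀ w k, 0 ≤ U w k) (hU1 : ∀ k, ∑ w, U w k = 1)
    (hT : ∀ w k, 0 ≤ T w k) (hT1 : ∀ k, ∑ w, T w k = 1)
    {a b : Fin K → ι} (ha : ∀ k, p ≤ U (a k) k) (ha0 : ∀ k l, l ≠ k → U (a k) l = 0)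
    (hb : ∀ k, p ≤ T (b k) k) (hb0 : ∀ k l, l ≠ k → T (b k) l = 0)
    (hV : ∀ x : Fin K → ℝ, q * ∑ k, |x k| ≤ ∑ z, |∑ k, x k * V k z|)
    (he : ∑ w, ∑ z, |∑ k, T w k * W k z - ∑ k, U w k * V k z| ≤ e)
    (h₁ : (1 / p + K / p ^ 2) / q * e ≤ 1 / 2)
    (h₂ : 4 * (K : ℝ) ^ 2 * ((1 / p + K / p ^ 2) / q * e) < p ^ 2) :
    ∃ σ : Equiv.Perm (Fin K), ∀ w, ∑ j, |T w (σ j) - U w j| ≤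
      2 * K * ((1 + K / p) / q + 2 * K ^ 2 / p * ((1 / p + K / p ^ 2) / q)) * e := by
  have he0 : 0 ≤ e := (sum_nonneg fun _ _ => sum_nonneg fun _ _ => abs_nonneg _).trans he
  set A : Fin K → Fin K → ℝ := fun k l => T (a k) l / U (a k) k with hA
  set B : Fin K → Fin K → ℝ := fun k l => U (b k) l / T (b k) k with hB
  set η : ℝ := (1 / p + K / p ^ 2) / q * e with hη
  have hη0 : 0 ≤ η := by positivity
  have hle1 : ∀ {X : ι → Fin K → ℝ}, (∀ w k, 0 ≤ X w k) → (∀ k, ∑ w, X w k = 1) →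
      ∀ w k, X w k ≤ 1 := fun h h' w k =>
    (single_le_sum (fun w _ => h w k) (mem_univ w)).trans (h' k).le
  have hA0 : ∀ k l, 0 ≤ A k l := fun k l => div_nonneg (hT _ _) (hU _ _)
  have hB0 : ∀ k l, 0 ≤ B k l := fun k l => div_nonneg (hU _ _) (hT _ _)
  have hA1 : ∀ k l, A k l ≤ 1 / p := fun k l =>
    div_le_div₀ zero_le_one (hle1 hT hT1 _ _) hp (ha k)
  have hB1 : ∀ k l, B k l ≤ 1 / p := fun k l =>
    div_le_div₀ zero_le_one (hle1 hU hU1 _ _) hp (hb k)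
  have hVA := sum_abs_sub_anchor_combination_le (T := T) (W := W) hp ha ha0 he
  have hWB := sum_abs_sub_anchor_combination_le (U := T) (T := U) (V := W) (W := V) (e := e)
    hp hb hb0 (by simpa only [abs_sub_comm] using he)
  -- the two changes of basis are almost inverse to each other
  have hAB : ∀ k, ∑ j, |(if j = k then 1 else 0) - ∑ l, A k l * B l j| ≤ η := by
    intro k
    have h1 : q * ∑ j, |(if j = k then 1 else 0) - ∑ l, A k l * B l j| ≤
        e / p + K * (1 / p * (e / p)) := by
      refine (hV _).trans ?_
      calc ∑ z, |∑ j, ((if j = k then 1 else 0) - ∑ l, A k l * B l j) * V j z|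
          ≤ ∑ z, (|V k z - ∑ l, A k l * W l z| +
              ∑ l, 1 / p * |W l z - ∑ j, B l j * V j z|) := by
            refine sum_le_sum fun z _ => ?_
            have e1 : ∑ j, ((if j = k then 1 else 0) - ∑ l, A k l * B l j) * V j z =
                (V k z - ∑ l, A k l * W l z) + ∑ l, A k l * (W l z - ∑ j, B l j * V j z) := by
              simp only [sub_mul, sum_sub_distrib, mul_sub, ite_mul, one_mul, zero_mul,
                sum_ite_eq', mem_univ, if_true, sum_mul, mul_sum]
              rw [sum_comm]
              simp only [mul_assoc]
              ring
            rw [e1]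
            refine (abs_add_le _ _).trans (add_le_add le_rfl ((abs_sum_le_sum_abs _ _).trans ?_))
            refine sum_le_sum fun l _ => ?_
            rw [abs_mul, abs_of_nonneg (hA0 k l)]
            exact mul_le_mul_of_nonneg_right (hA1 k l) (abs_nonneg _)
        _ = ∑ z, |V k z - ∑ l, A k l * W l z| +
              ∑ l, 1 / p * ∑ z, |W l z - ∑ j, B l j * V j z| := by
            rw [sum_add_distrib, sum_comm]
            simp only [mul_sum]
        _ ≤ e / p + ∑ _l : Fin K, 1 / p * (e / p) := by
            refine add_le_add (hVA k) (sum_le_sum fun l _ => ?_)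
            exact mul_le_mul_of_nonneg_left (hWB l) (by positivity)
        _ = _ := by simp
    have e2 : e / p + K * (1 / p * (e / p)) = q * η := by rw [hη]; field_simp
    rw [e2] at h1
    exact le_of_mul_le_mul_left h1 hq
  have hdiag : ∀ k, ∃ l, 1 / 2 ≤ K * (A k l * B l k) := by
    intro k
    have h1 : |1 - ∑ l, A k l * B l k| ≤ 1 / 2 := by
      have := (single_le_sum
        (f := fun j => |(if j = k then (1 : ℝ) else 0) - ∑ l, A k l * B l j|)
        (fun _ _ => abs_nonneg _) (mem_univ k)).trans (hAB k)
      simp only [if_true] at this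
      exact this.trans h₁
    have h2 : ∑ _l : Fin K, (1 / 2 : ℝ) ≤ ∑ l, K * (A k l * B l k) := by
      rw [← mul_sum]
      simp only [sum_const, card_univ, Fintype.card_fin, nsmul_eq_mul]
      exact mul_le_mul_of_nonneg_left (by linarith [(abs_le.1 h1).2]) (Nat.cast_nonneg _)
    obtain ⟨l, -, hl⟩ := exists_le_of_sum_le ⟨k, mem_univ k⟩ h2
    exact ⟨l, hl⟩
  choose σ hσ using hdiag
  have hoff : ∀ k j, j ≠ k → B (σ k) j ≤ 2 * K / p * η := by
    intro k j hjk
    have h1 : A k (σ k) * B (σ k) j ≤ η := by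
      have h2 := (single_le_sum
        (f := fun j => |(if j = k then (1 : ℝ) else 0) - ∑ l, A k l * B l j|)
        (fun _ _ => abs_nonneg _) (mem_univ j)).trans (hAB k)
      simp only [hjk, if_false, zero_sub, abs_neg] at h2
      refine (single_le_sum (f := fun l => A k l * B l j)
        (fun l _ => mul_nonneg (hA0 k l) (hB0 l j)) (mem_univ (σ k))).trans
        ((le_abs_self _).trans h2)
    have h3 : p ≤ 2 * (K * A k (σ k)) := by
      have h4 : K * A k (σ k) * B (σ k) k ≤ K * A k (σ k) * (1 / p) :=
        mul_le_mul_of_nonneg_left (hB1 _ _) (mul_nonneg (Nat.cast_nonneg _) (hA0 _ _))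
      have h5 : 1 / 2 ≤ K * A k (σ k) * (1 / p) := by linarith [hσ k]
      rw [mul_one_div, le_div_iff₀ hp] at h5
      linarith
    have h6 : p * B (σ k) j ≤ 2 * K * η := by
      calc p * B (σ k) j ≤ 2 * (K * A k (σ k)) * B (σ k) j :=
            mul_le_mul_of_nonneg_right h3 (hB0 _ _)
        _ = 2 * K * (A k (σ k) * B (σ k) j) := by ring
        _ ≤ 2 * K * η := by gcongr
    rw [div_mul_eq_mul_div, le_div_iff₀ hp]
    linarith
  have hon : ∀ k, p ≤ 2 * (K * B (σ k) k) := by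
    intro k
    have h4 : A k (σ k) * (K * B (σ k) k) ≤ 1 / p * (K * B (σ k) k) :=
      mul_le_mul_of_nonneg_right (hA1 _ _) (mul_nonneg (Nat.cast_nonneg _) (hB0 _ _))
    have h5 : 1 / 2 ≤ 1 / p * (K * B (σ k) k) := by linarith [hσ k]
    rw [one_div_mul_eq_div, le_div_iff₀ hp] at h5
    linarith
  have hinj : Function.Injective σ := by
    intro k k' h
    by_contra hne
    have h1 := hoff k k' (Ne.symm hne)
    have h2 := hon k'
    rw [← h] at h2
    have h3 : p ≤ 2 * (K * (2 * K / p * η)) := h2.trans (by gcongr)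
    have h4 : 2 * (K * (2 * K / p * η)) * p = 4 * (K : ℝ) ^ 2 * η := by field_simp; ring
    have h5 : p * p ≤ 4 * (K : ℝ) ^ 2 * η := by
      rw [← h4]; exact mul_le_mul_of_nonneg_right h3 hp.le
    rw [sq] at h₂
    linarith
  let τ : Equiv.Perm (Fin K) := Equiv.ofBijective σ (Finite.injective_iff_bijective.1 hinj)
  -- the left factors agree up to the change of basis
  have hUB : ∑ w, ∑ j, |U w j - ∑ l, T w l * B l j| ≤ (1 + K / p) / q * e := by
    have h1 : q * ∑ w, ∑ j, |U w j - ∑ l, T w l * B l j| ≤ e + K * (e / p) := by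
      rw [mul_sum]
      calc ∑ w, q * ∑ j, |U w j - ∑ l, T w l * B l j|
          ≤ ∑ w, ∑ z, |∑ j, (U w j - ∑ l, T w l * B l j) * V j z| :=
            sum_le_sum fun w _ => hV _
        _ ≤ ∑ w, ∑ z, (|∑ k, T w k * W k z - ∑ k, U w k * V k z| +
              ∑ l, T w l * |W l z - ∑ j, B l j * V j z|) := by
            refine sum_le_sum fun w _ => sum_le_sum fun z _ => ?_
            have e1 : ∑ j, (U w j - ∑ l, T w l * B l j) * V j z =
                -(∑ k, T w k * W k z - ∑ k, U w k * V k z) +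
                  ∑ l, T w l * (W l z - ∑ j, B l j * V j z) := by
              simp only [sub_mul, sum_sub_distrib, mul_sub, sum_mul, mul_sum]
              rw [sum_comm (s := univ) (t := univ) (f := fun x i => T w i * B i x * V x z)]
              simp only [mul_assoc]
              ring
            rw [e1]
            refine (abs_add_le _ _).trans ?_
            rw [abs_neg]
            refine add_le_add le_rfl ((abs_sum_le_sum_abs _ _).trans (sum_le_sum fun l _ => ?_))
            rw [abs_mul, abs_of_nonneg (hT w l)]
        _ = ∑ w, ∑ z, |∑ k, T w k * W k z - ∑ k, U w k * V k z| +
              ∑ l, (∑ w, T w l) * ∑ z, |W l z - ∑ j, B l j * V j z| := by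
            simp only [sum_add_distrib, sum_mul]
            congr 1
            conv_rhs => rw [sum_comm]
            refine sum_congr rfl fun w _ => ?_
            rw [sum_comm]
            simp only [mul_sum]
        _ ≤ e + ∑ _l : Fin K, e / p := by
            refine add_le_add he (sum_le_sum fun l _ => ?_)
            rw [hT1, one_mul]
            exact hWB l
        _ = _ := by simp
    have e2 : e + K * (e / p) = q * ((1 + K / p) / q * e) := by field_simp
    rw [e2] at h1
    exact le_of_mul_le_mul_left h1 hq
  set h : ℝ := (1 + K / p) / q * e + K * (2 * K / p * η) with hh
  have hcol : ∀ j, ∑ w, |U w j - T w (σ j) * B (σ j) j| ≤ h := by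
    intro j
    calc ∑ w, |U w j - T w (σ j) * B (σ j) j|
        ≤ ∑ w, (|U w j - ∑ l, T w l * B l j| + ∑ l ∈ univ.erase (σ j), T w l * B l j) := by
          refine sum_le_sum fun w _ => ?_
          have e1 : U w j - T w (σ j) * B (σ j) j = (U w j - ∑ l, T w l * B l j) +
              ∑ l ∈ univ.erase (σ j), T w l * B l j := by
            rw [← add_sum_erase _ _ (mem_univ (σ j))]; ring
          rw [e1]
          refine (abs_add_le _ _).trans (add_le_add le_rfl (le_of_eq ?_))
          exact abs_of_nonneg (sum_nonneg fun l _ => mul_nonneg (hT _ _) (hB0 _ _))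
      _ = ∑ w, |U w j - ∑ l, T w l * B l j| + ∑ l ∈ univ.erase (σ j), B l j := by
          rw [sum_add_distrib, sum_comm]
          congr 1
          refine sum_congr rfl fun l _ => ?_
          rw [← sum_mul, hT1, one_mul]
      _ ≤ (1 + K / p) / q * e + ∑ _l ∈ univ.erase (σ j), 2 * K / p * η := by
          refine add_le_add (le_trans (sum_le_sum fun w _ => ?_) hUB) (sum_le_sum fun l hl => ?_)
          · exact single_le_sum (f := fun j => |U w j - ∑ l, T w l * B l j|)
              (fun _ _ => abs_nonneg _) (mem_univ j)
          · obtain ⟨k, rfl⟩ := τ.surjective l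
            exact hoff k j fun hjk => (mem_erase.1 hl).1 (by rw [hjk]; rfl)
      _ ≤ _ := by
          rw [sum_const, nsmul_eq_mul, hh]
          have : ((univ.erase (σ j)).card : ℝ) ≤ K := by
            exact_mod_cast (card_le_univ _).trans (Fintype.card_fin K).le
          have h0 : 0 ≤ 2 * K / p * η := by positivity
          gcongr
  have hcol' : ∀ j, ∑ w, |T w (σ j) - U w j| ≤ 2 * h := by
    intro j
    have h1 : |1 - B (σ j) j| ≤ h := by
      have e1 : 1 - B (σ j) j = ∑ w, (U w j - T w (σ j) * B (σ j) j) := by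
        rw [sum_sub_distrib, ← sum_mul, hU1, hT1, one_mul]
      rw [e1]
      exact (abs_sum_le_sum_abs _ _).trans (hcol j)
    calc ∑ w, |T w (σ j) - U w j|
        ≤ ∑ w, (T w (σ j) * |1 - B (σ j) j| + |U w j - T w (σ j) * B (σ j) j|) := by
          refine sum_le_sum fun w _ => ?_
          have e1 : T w (σ j) - U w j = T w (σ j) * (1 - B (σ j) j) +
            -(U w j - T w (σ j) * B (σ j) j) := by ring
          rw [e1]
          refine (abs_add_le _ _).trans ?_
          rw [abs_neg, abs_mul, abs_of_nonneg (hT _ _)]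
      _ ≤ 2 * h := by
          rw [sum_add_distrib, ← sum_mul, hT1, one_mul]
          linarith [hcol j]
  refine ⟨τ, fun w => ?_⟩
  calc ∑ j, |T w (τ j) - U w j| ≤ ∑ _j : Fin K, 2 * h := by
        refine sum_le_sum fun j _ => le_trans ?_ (hcol' j)
        exact single_le_sum (f := fun w => |T w (σ j) - U w j|) (fun _ _ => abs_nonneg _)
          (mem_univ w)
    _ = _ := by
        simp only [sum_const, card_univ, Fintype.card_fin, nsmul_eq_mul]
        rw [hh, hη]
        ring

end Stability

/-! ### Second moments -/

section Moments

open Finset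

variable {Ω : Type*} [MeasurableSpace Ω] {P : Measure Ω} {K m n : ℕ}
  {Λ : Ω → Matrix (Fin K) (Fin m) ℝ}

theorem ColumnStochastic.le_one {r : ℕ} {A : Matrix (Fin n) (Fin r) ℝ} (h : ColumnStochastic A)
    (i : Fin n) (j : Fin r) : A i j ≤ 1 :=
  (single_le_sum (f := fun i => A i j) (fun i _ => h.1 i j) (mem_univ i)).trans (h.2 j).le

theorem integrable_mul_transpose [IsProbabilityMeasure P]
    (hm : ∀ k d, AEMeasurable (fun ω => Λ ω k d) P)
    (hs : ∀ᵐ ω ∂P, ColumnStochastic (Λ ω)) (k l : Fin K) :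
    Integrable (fun ω => (Λ ω * (Λ ω).transpose) k l) P := by
  simp only [Matrix.mul_apply, Matrix.transpose_apply]
  refine integrable_finsetSum _ fun d _ => ?_
  refine Integrable.of_bound ((hm k d).mul (hm l d)).aestronglyMeasurable 1 ?_
  filter_upwards [hs] with ω h
  rw [Real.norm_eq_abs, abs_of_nonneg (mul_nonneg (h.1 _ _) (h.1 _ _))]
  exact mul_le_one₀ (h.le_one _ _) (h.1 _ _) (h.le_one _ _)

theorem secondMoment_nonneg (hs : ∀ᵐ ω ∂P, ColumnStochastic (Λ ω)) (k l : Fin K) :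
    0 ≤ secondMoment P Λ k l := by
  refine integral_nonneg_of_ae ?_
  filter_upwards [hs] with ω h
  simp only [Matrix.mul_apply, Matrix.transpose_apply, Pi.zero_apply]
  exact sum_nonneg fun d _ => mul_nonneg (h.1 _ _) (h.1 _ _)

theorem sum_secondMoment [IsProbabilityMeasure P]
    (hm : ∀ k d, AEMeasurable (fun ω => Λ ω k d) P)
    (hs : ∀ᵐ ω ∂P, ColumnStochastic (Λ ω)) : ∑ k, ∑ l, secondMoment P Λ k l = m := by
  have hint := integrable_mul_transpose hm hs
  simp only [secondMoment, Matrix.of_apply]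
  rw [sum_congr rfl fun k _ => (integral_finsetSum univ fun l _ => hint k l).symm,
    ← integral_finsetSum univ fun k _ => integrable_finsetSum _ fun l _ => hint k l]
  have : (fun ω => ∑ k, ∑ l, (Λ ω * (Λ ω).transpose) k l) =ᵐ[P] fun _ => (m : ℝ) := by
    filter_upwards [hs] with ω h
    simp only [Matrix.mul_apply, Matrix.transpose_apply]
    rw [sum_congr rfl fun k _ => sum_comm, sum_comm]
    simp only [← mul_sum, ← sum_mul, h.2]
    simp
  rw [integral_congr_ae this]
  simp

theorem secondMoment_mul [IsProbabilityMeasure P]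
    (hm : ∀ k d, AEMeasurable (fun ω => Λ ω k d) P)
    (hs : ∀ᵐ ω ∂P, ColumnStochastic (Λ ω)) (U : Matrix (Fin n) (Fin K) ℝ) (i j : Fin n) :
    secondMoment P (fun ω => U * Λ ω) i j =
      ∑ k, U i k * ∑ l, secondMoment P Λ k l * U j l := by
  have hint := integrable_mul_transpose hm hs
  have h1 : ∀ ω, (U * Λ ω * (U * Λ ω).transpose) i j =
      ∑ k, ∑ l, U i k * ((Λ ω * (Λ ω).transpose) k l * U j l) := by
    intro ω
    rw [Matrix.transpose_mul, ← Matrix.mul_assoc, Matrix.mul_assoc U, Matrix.mul_assoc U,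
      Matrix.mul_apply]
    refine sum_congr rfl fun k _ => ?_
    rw [Matrix.mul_apply, mul_sum]
    rfl
  simp only [secondMoment, Matrix.of_apply, h1]
  rw [integral_finsetSum univ fun k _ => integrable_finsetSum _ fun l _ =>
    ((hint k l).mul_const _).const_mul _]
  refine sum_congr rfl fun k _ => ?_
  rw [integral_finsetSum univ fun l _ => ((hint k l).mul_const _).const_mul _, mul_sum]
  refine sum_congr rfl fun l _ => ?_
  rw [integral_const_mul, integral_mul_const]

end Moments

section Main

open Finset RealRAM

variable {K n : ℕ}

theorem Matrix.extendZero_val (S : Matrix (Fin n) (Fin n) ℝ) (i j : Fin n) :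
    S.extendZero i j = S i j := by
  simp [Matrix.extendZero]

/-- The second moment matrix of a topic model, as a product of a nonnegative matrix of weight `m`
and of a matrix with row sums at most one. -/
theorem exists_normalized_factorization {U : Matrix (Fin n) (Fin K) ℝ} (hU : ColumnStochastic U)
    {R : Matrix (Fin K) (Fin K) ℝ} (hR : ∀ k l, 0 ≤ R k l) :
    ∃ (A : ℕ → Fin K → ℝ) (V : Fin K → ℕ → ℝ),
      (∀ w k, 0 ≤ A w k) ∧ (∀ k z, 0 ≤ V k z) ∧
      ∑ w ∈ range n, ∑ k, A w k = ∑ k, ∑ l, R k l ∧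
      (∀ k, ∑ z ∈ range n, V k z ≤ 1) ∧ (∀ w k, A w k * ∑ z ∈ range n, V k z = A w k) ∧
      (∀ (w : Fin n) k, A w k = U w k * ∑ l, R k l) ∧
      ∀ w z : Fin n, ∑ k, A w k * V k z = ∑ k, U w k * ∑ l, R k l * U z l := by
  set ρ : Fin K → ℝ := fun k => ∑ l, R k l with hρ
  have hρ0 : ∀ k, 0 ≤ ρ k := fun k => sum_nonneg fun l _ => hR k l
  set A : ℕ → Fin K → ℝ := fun w k => if h : w < n then U ⟨w, h⟩ k * ρ k else 0 with hA
  set V : Fin K → ℕ → ℝ :=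
    fun k z => if h : z < n then (∑ l, R k l * U ⟨z, h⟩ l) / ρ k else 0 with hV
  have hAv : ∀ (w : Fin n) k, A w k = U w k * ρ k := fun w k => by simp [hA]
  have hVv : ∀ k (z : Fin n), V k z = (∑ l, R k l * U z l) / ρ k := fun k z => by simp [hV]
  have hVs : ∀ k, ∑ z ∈ range n, V k z = ρ k / ρ k := by
    intro k
    rw [Finset.sum_range]
    simp only [hVv]
    rw [← sum_div, sum_comm]
    simp only [← mul_sum, hU.2, mul_one, hρ]
  refine ⟨A, V, ?_, ?_, ?_, ?_, ?_, hAv, ?_⟩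
  · intro w k
    simp only [hA]
    split_ifs
    · exact mul_nonneg (hU.1 _ _) (hρ0 k)
    · exact le_rfl
  · intro k z
    simp only [hV]
    split_ifs
    · exact div_nonneg (sum_nonneg fun l _ => mul_nonneg (hR _ _) (hU.1 _ _)) (hρ0 k)
    · exact le_rfl
  · rw [Finset.sum_range, sum_comm]
    simp only [hAv, ← sum_mul, hU.2, one_mul, hρ]
  · intro k
    rw [hVs]
    exact div_self_le_one _
  · intro w k
    rw [hVs]
    by_cases h : ρ k = 0
    · have : A w k = 0 := by simp [hA, h]
      rw [this, zero_mul]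
    · rw [div_self h, mul_one]
  · intro w z
    refine sum_congr rfl fun k _ => ?_
    rw [hAv, hVv]
    by_cases h : ρ k = 0
    · have h0 : ∀ l, R k l = 0 := fun l =>
        (sum_eq_zero_iff_of_nonneg fun l _ => hR k l).1 h l (mem_univ l)
      simp [h0]
    · field_simp

/-- The right factor of a separable topic model is well conditioned. -/
theorem mul_sum_abs_le_of_separable {U : Matrix (Fin n) (Fin K) ℝ} {R : Matrix (Fin K) (Fin K) ℝ}
    {p γ : ℝ} (hp : 0 < p) (hR : L1Conditioned γ R) {a : Fin K → Fin n}
    (hinj : Function.Injective a) (ha : ∀ k, p ≤ U (a k) k)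
    (ha0 : ∀ k l, l ≠ k → U (a k) l = 0) (x : Fin K → ℝ) :
    p * γ * ∑ k, |x k| ≤ ∑ z, |∑ k, x k * ∑ l, R k l * U z l| := by
  have e1 : ∀ z, ∑ k, x k * ∑ l, R k l * U z l = ∑ l, Matrix.vecMul x R l * U z l := by
    intro z
    simp only [Matrix.vecMul, dotProduct, sum_mul, mul_sum]
    rw [sum_comm]
    simp only [mul_assoc]
  simp only [e1]
  calc p * γ * ∑ k, |x k| ≤ p * ∑ l, |Matrix.vecMul x R l| := by
        rw [mul_assoc]; exact mul_le_mul_of_nonneg_left (hR x) hp.le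
    _ ≤ ∑ l, |∑ j, Matrix.vecMul x R j * U (a l) j| := by
        rw [mul_sum]
        refine sum_le_sum fun l _ => ?_
        rw [sum_eq_single l (fun j _ hj => by rw [ha0 l j hj, mul_zero]) (by simp), abs_mul,
          abs_of_nonneg (hp.le.trans (ha l)), mul_comm]
        exact mul_le_mul_of_nonneg_left (ha l) (abs_nonneg _)
    _ = ∑ z ∈ univ.image a, |∑ j, Matrix.vecMul x R j * U z j| := by
        rw [sum_image fun _ _ _ _ h => hinj h]
    _ ≤ _ := sum_le_sum_of_subset_of_nonneg (subset_univ _) fun _ _ _ => abs_nonneg _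

theorem le_sum_of_l1Conditioned {R : Matrix (Fin K) (Fin K) ℝ} (hR0 : ∀ k l, 0 ≤ R k l) {γ : ℝ}
    (hR : L1Conditioned γ R) (k : Fin K) : γ ≤ ∑ l, R k l := by
  have h := hR (Pi.single k 1)
  have h1 : ∑ j, |(Pi.single k 1 : Fin K → ℝ) j| = 1 := by
    rw [sum_eq_single k (fun j _ hj => by simp [hj]) (by simp)]
    simp
  rw [h1, mul_one] at h
  refine h.trans (le_of_eq (sum_congr rfl fun l _ => ?_))
  rw [Matrix.single_one_vecMul]
  exact abs_of_nonneg (hR0 k l)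

theorem entrywiseL1_sub_le {r : ℕ} (A B C : Matrix (Fin n) (Fin r) ℝ) :
    entrywiseL1 (A - C) ≤ entrywiseL1 (A - B) + entrywiseL1 (B - C) := by
  simp only [entrywiseL1, Matrix.sub_apply, ← sum_add_distrib]
  exact sum_le_sum fun i _ => sum_le_sum fun j _ => abs_sub_le _ _ _

namespace FitConstants

variable {N : ℕ}

theorem anchored_le_left (c : FitConstants K N) (hc : c.anchored) {G : List (Fin K → ℚ)}
    (hG : ∀ g ∈ G, ∀ i, 0 ≤ g i ∧ g i ≤ 1) (n : ℕ) (S : ℕ → ℕ → ℝ) (rep : Fin N → ℕ)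
    {anchor : Fin K → ℕ} (hinj : Function.Injective anchor) {q M : ℝ} (hq : 0 < q) (k : Fin K)
    (hk : anchor k < n) (h : q ≤ rowMass n S (anchor k))
    (hM : ∑ w ∈ range n, rowMass n S w ≤ M) :
    q / M ≤ c.left G n S rep anchor (anchor k) k := by
  have h1 := c.rawLeft_anchor (G := G) n S rep anchor hc hinj k
  have h2 : q ≤ c.topicMass G n S rep anchor k :=
    (h.trans h1.ge).trans (single_le_sum (f := fun w => c.rawLeft G n S rep anchor w k)
      (fun w _ => c.rawLeft_nonneg n S rep anchor hG w k) (mem_range.2 hk))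
  have h3 : c.topicMass G n S rep anchor k ≤ M :=
    (sum_le_sum fun w _ => c.rawLeft_le n S rep anchor hG w k).trans hM
  rw [left, h1]
  exact div_le_div₀ (hq.le.trans h) h (hq.trans_le h2) h3

theorem residual_le_of_score {c : FitConstants K N} {G : List (Fin K → ℚ)} {n : ℕ}
    {S : ℕ → ℕ → ℝ} {rep : Fin N → ℕ} {anchor : Fin K → ℕ} {τ : ℚ}
    (h : -1 < c.score G n S rep anchor τ) : c.residual G n S rep anchor ≤ τ := by
  by_contra hc
  rw [score, if_neg hc] at h
  exact lt_irrefl _ h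

theorem residual_eq_entrywiseL1 (c : FitConstants K N) (G : List (Fin K → ℚ))
    (S : Matrix (Fin n) (Fin n) ℝ) (rep : Fin N → ℕ) (anchor : Fin K → ℕ)
    {L : Matrix (Fin n) (Fin K) ℝ} {F : Matrix (Fin K) (Fin n) ℝ}
    (hL : ∀ i k, L i k = c.left G n S.extendZero rep anchor i k)
    (hF : ∀ k i, F k i = c.right G n S.extendZero rep anchor k i) :
    c.residual G n S.extendZero rep anchor = entrywiseL1 (L * F - S) := by
  rw [residual, sum_comm, Finset.sum_range, entrywiseL1]
  refine sum_congr rfl fun i _ => ?_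
  rw [Finset.sum_range]
  refine sum_congr rfl fun j _ => ?_
  rw [Matrix.extendZero_val, Matrix.sub_apply, Matrix.mul_apply, abs_sub_comm]
  simp only [hL, hF]

end FitConstants

/-- The separability that the algorithm can certify, for a `p`-separable walk-topic matrix and
topic moments of condition number `γ`. -/
noncomputable def certifiedWeight (m : ℕ) (p γ : ℝ) : ℝ :=
  min (min p 1) (p * γ / 2 / (m + 1))

/-- The amplification of the error in the change of basis between two factorisations. -/
noncomputable def basisCondition (K m : ℕ) (p γ : ℝ) : ℝ :=
  (1 / certifiedWeight m p γ + K / certifiedWeight m p γ ^ 2) / (p * γ)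

/-- The precision below which the topics are identified. -/
noncomputable def identificationThreshold (K m : ℕ) (p γ : ℝ) : ℝ :=
  min (min 1 (p * γ)) (certifiedWeight m p γ ^ 2 / (8 * (K + 1) ^ 2 * basisCondition K m p γ))

/-- The constant in the recovery of the anchor rows. -/
noncomputable def recoveryConstant (K m : ℕ) (p γ : ℝ) : ℝ :=
  2 * K * ((1 + K / certifiedWeight m p γ) / (p * γ) +
    2 * K ^ 2 / certifiedWeight m p γ * basisCondition K m p γ) +
  K / identificationThreshold K m p γ

theorem certifiedWeight_pos (m : ℕ) {p γ : ℝ} (hp : 0 < p) (hγ : 0 < γ) :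
    0 < certifiedWeight m p γ := by
  unfold certifiedWeight; positivity

theorem basisCondition_pos (K m : ℕ) {p γ : ℝ} (hp : 0 < p) (hγ : 0 < γ) :
    0 < basisCondition K m p γ := by
  have := certifiedWeight_pos m hp hγ
  unfold basisCondition; positivity

theorem identificationThreshold_pos (K m : ℕ) {p γ : ℝ} (hp : 0 < p) (hγ : 0 < γ) :
    0 < identificationThreshold K m p γ := by
  have := certifiedWeight_pos m hp hγ
  have := basisCondition_pos K m hp hγ
  unfold identificationThreshold; positivity

end Main

/-- `K` topics and `m` nodes are fixed, the number `n` of walks is the size of the input. -/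
theorem corollary1 (K m : ℕ) :
    ∃ c : ℝ, 0 < c ∧ ∃ C : ℝ → ℝ → ℝ, ∀ ε : ℝ, 0 < ε →
      ∃ A : RealRAM.Program, A.PolyTime ∧
        ∀ (n : ℕ) (U : Matrix (Fin n) (Fin K) ℝ), ColumnStochastic U →
        ∀ (Ω : Type*) [MeasurableSpace Ω] (P : Measure Ω) [IsProbabilityMeasure P]
          (Λ : Ω → Matrix (Fin K) (Fin m) ℝ),
          (∀ k d, AEMeasurable (fun ω => Λ ω k d) P) →
          (∀ᵐ ω ∂P, ColumnStochastic (Λ ω)) →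
        ∀ S Shat : Matrix (Fin n) (Fin n) ℝ,
          S = secondMoment P (fun ω => U * Λ ω) →
          entrywiseL1 (Shat - S) ≤ c * ε →
          ((∀ i k, 0 ≤ A.leftFactor K Shat i k) ∧ (∀ k j, 0 ≤ A.rightFactor K Shat k j) ∧
            entrywiseL1 (A.leftFactor K Shat * A.rightFactor K Shat - S) ≤ ε) ∧
          ∀ p γ : ℝ, 0 < p → 0 < γ → PSeparable p U → L1Conditioned γ (secondMoment P Λ) →
            ∃ σ : Equiv.Perm (Fin K), ∀ (w : Fin n) (k : Fin K), IsAnchor U w k →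
              ∑ j, |A.leftFactor K Shat w (σ j) - U w j| ≤ C p γ * ε := by
  set Q : ℝ := (1 + K) * (5 + K) + 1 with hQ
  have hQ1 : 1 ≤ Q := by rw [hQ]; linarith [show (0 : ℝ) ≤ (1 + K) * (5 + K) by positivity]
  refine ⟨1 / (4 * Q), by positivity, recoveryConstant K m, fun ε hε => ?_⟩
  set e : ℝ := 1 / (4 * Q) * ε with he
  have he0 : 0 < e := by positivity
  have hQe : Q * e = ε / 4 := by rw [he]; field_simp
  have heε : e ≤ ε / 4 := by nlinarith
  obtain ⟨N, G, cs, hG, hcs⟩ := FitConstants.exists_constants K m he0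
  obtain ⟨τ, hτ1, hτ2⟩ := exists_rat_btwn (show ε / 4 < ε / 2 by linarith)
  obtain ⟨A, hA, hspec⟩ := (FitConstants.searchProblem K N G τ).exists_program cs
  refine ⟨A, hA, fun n U hU Ω _ P _ Λ hm hs S Shat hS hE => ?_⟩
  rcases Nat.eq_zero_or_pos n with rfl | hn
  · refine ⟨⟨fun i => i.elim0, fun _ j => j.elim0, ?_⟩, fun _ _ _ _ _ _ => ⟨1, fun w => w.elim0⟩⟩
    simpa [entrywiseL1] using hε.le
  set R := secondMoment P Λ with hR
  have hR0 : ∀ k l, 0 ≤ R k l := secondMoment_nonneg hs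
  obtain ⟨F, V, hF0, hV0, hFm, hV1, hFV, hFU, hprod⟩ := exists_normalized_factorization hU hR0
  have hS' : ∀ w z, S w z = ∑ k, U w k * ∑ l, R k l * U z l := fun w z => by
    rw [hS]; exact secondMoment_mul hm hs U w z
  have hFm' : ∑ w ∈ Finset.range n, ∑ k, F w k ≤ m := (hFm.trans (sum_secondMoment hm hs)).le
  have hE' : ∑ w ∈ Finset.range n, ∑ z ∈ Finset.range n,
      |Shat.extendZero w z - ∑ k, F w k * V k z| ≤ e := by
    refine le_trans (le_of_eq ?_) hE
    rw [Finset.sum_range, entrywiseL1]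
    refine Finset.sum_congr rfl fun w _ => ?_
    rw [Finset.sum_range]
    refine Finset.sum_congr rfl fun z _ => ?_
    rw [Matrix.extendZero_val, hprod, Matrix.sub_apply, hS']
  have hcand : ∀ (anchored : Bool) (anchor : Fin K → ℕ), (∀ k, anchor k < n) →
      (anchored → Function.Injective anchor ∧ ∀ j k, k ≠ j → F (anchor j) k = 0) →
      ∃ c ∈ cs, c.anchored = anchored ∧ ∃ (rep : Fin N → ℕ) (v : Fin (N + K) → ℕ),
        (∀ i, v i < n) ∧ (∀ b, v (Fin.castAdd K b) = rep b) ∧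
        (∀ k, v (Fin.natAdd N k) = anchor k) ∧
        c.residual G n Shat.extendZero rep anchor ≤ τ := by
    intro anchored anchor hlt hanc
    obtain ⟨c, hc, hca, rep, hrep, hres⟩ :=
      hcs n Shat.extendZero F V hn hF0 hV0 hFm' hV1 hFV hE' anchored anchor hanc
    refine ⟨c, hc, hca, rep, Fin.addCases rep anchor, ?_, by simp, by simp, ?_⟩
    · intro i
      refine Fin.addCases (fun b => ?_) (fun k => ?_) i
      · simpa using hrep b
      · simpa using hlt k
    · refine hres.trans ?_
      rw [← hQ, hQe]
      exact hτ1.le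
  obtain ⟨c₀, hc₀, hca₀, rep₀, v₀, hv₀, hr₀, ha₀, hres₀⟩ := hcand false (fun _ => 0)
    (fun _ => hn) (by simp)
  rcases hspec n Shat with ⟨-, -, hbad⟩ | ⟨c, v, hv, hscore, hL, hF, hbest⟩
  · have := hbad c₀ hc₀ v₀ hv₀
    simp only [FitConstants.searchProblem, hr₀, ha₀] at this
    rw [FitConstants.score, if_pos hres₀, hca₀] at this
    norm_num at this
  set rep : Fin N → ℕ := fun b => v (Fin.castAdd K b) with hrep
  set anchor : Fin K → ℕ := fun k => v (Fin.natAdd N k) with hanchor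
  have hscore' : -1 < c.score G n Shat.extendZero rep anchor τ := hscore
  have hL' : ∀ i k, A.leftFactor K Shat i k = c.left G n Shat.extendZero rep anchor i k := hL
  have hF' : ∀ k i, A.rightFactor K Shat k i = c.right G n Shat.extendZero rep anchor k i := hF
  have hL0 : ∀ i k, 0 ≤ A.leftFactor K Shat i k := fun i k => by
    rw [hL']; exact c.left_nonneg _ _ _ _ hG _ _
  have hL1 : ∀ i k, A.leftFactor K Shat i k ≤ 1 := fun i k => by
    rw [hL']; exact c.left_le_one _ _ _ _ hG i.2 _
  have hclose : entrywiseL1 (A.leftFactor K Shat * A.rightFactor K Shat - S) ≤ ε := by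
    have h1 := FitConstants.residual_le_of_score hscore'
    rw [c.residual_eq_entrywiseL1 G Shat rep anchor hL' hF'] at h1
    have h2 := entrywiseL1_sub_le (A.leftFactor K Shat * A.rightFactor K Shat) Shat S
    linarith
  refine ⟨⟨hL0, fun k j => by rw [hF']; exact c.right_nonneg _ _ _ _ hG _ _, hclose⟩, ?_⟩
  intro p γ hp hγ hsep hcond
  set p₀ := certifiedWeight m p γ with hp₀
  set κ := basisCondition K m p γ with hκ
  set ε₀ := identificationThreshold K m p γ with hε₀
  have hp₀0 : 0 < p₀ := certifiedWeight_pos m hp hγ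
  have hκ0 : 0 < κ := basisCondition_pos K m hp hγ
  have hε₀0 : 0 < ε₀ := identificationThreshold_pos K m hp hγ
  set C₁ : ℝ := 2 * K * ((1 + K / p₀) / (p * γ) + 2 * K ^ 2 / p₀ * κ) with hC₁
  have hC₁0 : 0 ≤ C₁ := by positivity
  have hC : recoveryConstant K m p γ = C₁ + K / ε₀ := rfl
  by_cases hsmall : ε ≤ ε₀
  · -- small `ε`: the factorisation found is separable, hence close to the true one
    have hε1 : ε ≤ 1 := hsmall.trans ((min_le_left _ _).trans (min_le_left _ _))
    have hε2 : ε ≤ p * γ := hsmall.trans ((min_le_left _ _).trans (min_le_right _ _))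
    have hε3 : ε ≤ p₀ ^ 2 / (8 * (K + 1) ^ 2 * κ) := hsmall.trans (min_le_right _ _)
    choose a hanc hap using hsep.2
    have ha0 : ∀ k l, l ≠ k → U (a k) l = 0 := fun k l hl => (hanc k).2 l hl
    have hinj : Function.Injective a := by
      intro j k hjk
      by_contra hne
      exact (hanc j).1 (by rw [hjk]; exact ha0 k j hne)
    have hinj' : Function.Injective fun k => (a k : ℕ) := Fin.val_injective.comp hinj
    obtain ⟨c₁, hc₁, hca₁, rep₁, v₁, hv₁, hr₁, ha₁, hres₁⟩ := hcand true (fun k => a k)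
      (fun k => (a k).2) fun _ => ⟨hinj', fun j k hk => by rw [hFU, ha0 j k hk, zero_mul]⟩
    have hw₁ : ∀ k, p₀ ≤ c₁.left G n Shat.extendZero rep₁ (fun k => a k) (a k) k := by
      intro k
      refine (min_le_right _ _).trans ?_
      refine c₁.anchored_le_left hca₁ hG n _ rep₁ hinj' (by positivity) k (a k).2 ?_ ?_
      · have h1 := (abs_le.1 ((FitConstants.abs_sum_sub_rowMass_le n Shat.extendZero hF0 hV0 hFV
          (a k)).trans ((Finset.single_le_sum (f := fun w => ∑ z ∈ Finset.range n,
            |Shat.extendZero w z - ∑ k, F w k * V k z|)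
            (fun _ _ => Finset.sum_nonneg fun _ _ => abs_nonneg _)
            (Finset.mem_range.2 (a k).2)).trans hE'))).2
        have h2 : p * γ ≤ ∑ l, F (a k) l := by
          refine le_trans ?_ (Finset.single_le_sum (fun l _ => hF0 (a k) l) (Finset.mem_univ k))
          rw [hFU]
          exact mul_le_mul (hap k) (le_sum_of_l1Conditioned hR0 hcond k) hγ.le (hU.1 _ _)
        linarith
      · have := FitConstants.sum_rowMass_le n Shat.extendZero hF0 hV0 hFm' hFV hE'
        linarith
    have hs₁ : p₀ ≤ c.score G n Shat.extendZero rep anchor τ := by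
      have h1 := hbest c₁ hc₁ v₁ hv₁
      simp only [FitConstants.searchProblem, hr₁, ha₁] at h1
      refine le_trans ?_ h1
      rw [FitConstants.score, if_pos hres₁, if_pos hca₁]
      exact c₁.le_minAnchorWeight _ _ _ _ ((min_le_left _ _).trans (min_le_right _ _)) hw₁
    have hc : c.anchored := by
      by_contra hc
      rw [FitConstants.score, if_pos (FitConstants.residual_le_of_score hscore'), if_neg hc] at hs₁
      linarith
    rw [FitConstants.score, if_pos (FitConstants.residual_le_of_score hscore'), if_pos hc] at hs₁
    have hb : ∀ k, p₀ ≤ c.left G n Shat.extendZero rep anchor (anchor k) k := fun k =>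
      hs₁.trans (c.minAnchorWeight_le _ _ _ _ k)
    have hT1 : ∀ k, ∑ w, A.leftFactor K Shat w k = 1 := by
      intro k
      have h1 := c.sum_left (G := G) n Shat.extendZero rep anchor k
      rw [Finset.sum_range] at h1
      simp only [hL']
      rw [h1, if_neg]
      intro h0
      have := hb k
      rw [FitConstants.left, h0, div_zero] at this
      linarith
    have hclose' : ∑ w, ∑ z, |∑ k, A.leftFactor K Shat w k * A.rightFactor K Shat k z -
        ∑ k, U w k * ∑ l, R k l * U z l| ≤ ε := by
      refine le_trans (le_of_eq ?_) hclose
      simp only [entrywiseL1, Matrix.sub_apply, Matrix.mul_apply, hS']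
    have hκε : 8 * (K + 1) ^ 2 * (κ * ε) ≤ p₀ ^ 2 := by
      rw [le_div_iff₀ (by positivity)] at hε3
      linarith
    have hp₀1 : p₀ ^ 2 ≤ 1 :=
      pow_le_one₀ hp₀0.le ((min_le_left _ _).trans (min_le_right _ _))
    have hκε0 : 0 ≤ κ * ε := by positivity
    have hK1 : (1 : ℝ) ≤ (K + 1) ^ 2 := one_le_pow₀ (by simp)
    have hK2 : (K : ℝ) ^ 2 ≤ (K + 1) ^ 2 := by gcongr; simp
    obtain ⟨σ, hσ⟩ := exists_perm_sum_abs_sub_le (U := U) (T := A.leftFactor K Shat)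
      (V := fun k z => ∑ l, R k l * U z l) (W := A.rightFactor K Shat) (p := p₀) (q := p * γ)
      (e := ε) (a := a) (b := fun k => ⟨anchor k, hv _⟩) hp₀0 (by positivity) hU.1 hU.2 hL0 hT1
      (fun k => ((min_le_left _ _).trans (min_le_left _ _)).trans (hap k)) ha0
      (fun k => by rw [hL']; exact hb k)
      (fun k l hl => by rw [hL']; exact c.left_anchor_of_ne _ _ _ _ hc (Ne.symm hl))
      (mul_sum_abs_le_of_separable hp hcond hinj hap ha0) hclose'
      (by
        change κ * ε ≤ 1 / 2
        nlinarith [mul_le_mul_of_nonneg_right hK1 hκε0])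
      (by
        change 4 * (K : ℝ) ^ 2 * (κ * ε) < p₀ ^ 2
        have := mul_le_mul_of_nonneg_right hK2 hκε0
        have : 0 < p₀ ^ 2 := by positivity
        linarith)
    refine ⟨σ, fun w k _ => (hσ w).trans ?_⟩
    rw [hC]
    refine mul_le_mul_of_nonneg_right ?_ hε.le
    exact le_add_of_nonneg_right (by positivity)
  · refine ⟨1, fun w k _ => ?_⟩
    calc ∑ j, |A.leftFactor K Shat w ((1 : Equiv.Perm (Fin K)) j) - U w j|
        ≤ ∑ _j : Fin K, (1 : ℝ) := by
          refine Finset.sum_le_sum fun j _ => ?_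
          rw [abs_le]
          constructor <;> linarith [hL0 w j, hL1 w j, hU.1 w j, hU.le_one w j,
            show A.leftFactor K Shat w ((1 : Equiv.Perm (Fin K)) j) =
              A.leftFactor K Shat w j from rfl]
      _ = K / ε₀ * ε₀ := by simp [hε₀0.ne']
      _ ≤ K / ε₀ * ε := by
          have := (not_le.1 hsmall).le
          gcongr
      _ ≤ _ := by
          rw [hC]
          refine mul_le_mul_of_nonneg_right ?_ hε.le
          exact le_add_of_nonneg_left hC₁0
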